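/- Let $k\ge 2$ and $d\ge 2$ be integers and put $s=k-1$. Let $\mathcal F_d$ be the set of pairs $f=(f_\infty,R)$, where $R$ is a homogeneous polynomial of degree $d$ on $\mathbb C^{k}$ and $f_\infty=(F_0,\dots,F_s)$ is a $k$-tuple of homogeneous polynomials of degree $d$ on $\mathbb C^k$ whose only common zero is the origin; the induced holomorphic endomorphism of $\mathbb P^s$ is also denoted by $f_\infty$. For $f\in\mathcal F_d$ let $f_\infty^+:\mathbb P^s\to\mathbb P^k$ be the map $f_\infty^+(z)=[f_\infty(z):R(z)]$, and for $\varepsilon\in\mathbb C$ let $f_\varepsilon:\mathbb P^k\to\mathbb P^k$ be the map $[z':z_k]\mapsto[f_\infty(z'):z_k^d+\varepsilon R(z')]$. Define $$X_{-1}(f)=\{z\in\mathbb P^s:\ \sharp\,(f_\infty^+)^{-1}(f_\infty^+(z))\ge d^{s-1}+1\},\qquad X(f)=f_\infty(X_{-1}(f)),$$ where each point $z'$ of the fibre $(f_\infty^+)^{-1}(f_\infty^+(z))\subset f_\infty^{-1}(f_\infty(z))$ is counted with its multiplicity (local degree) as a preimage under $f_\infty$. Define also $Y(f)=f_\infty^2(Y_{-2}(f))$,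 where $Y_{-2}(f)$ is the set of points $z\in\mathbb P^s$ such that either $R(z)=0$, or there exists $z'\in\mathbb P^s$ with $$f_\infty^+(z)\neq f_\infty^+(z'),\qquad f_\infty(z)=f_\infty(z'),\qquad f_\varepsilon(f_\infty^+(z))=f_\varepsilon(f_\infty^+(z'))$$ (given the second equality, the third condition does not depend on $\varepsilon$; take $\varepsilon=1$). Put $Z(f)=X(f)\cup Y(f)$, and let $\Omega\subset\mathcal F_d$ be the set of those $f$ for which $X(f)\cap Y(f)=\varnothing$ and $\bigcap_{i=0}^n f_\infty^{-i}(Z(f))=\varnothing$ for some $n\in\mathbb N$. **Proposition.** There exists $f=(f_\infty,R)\in\mathcal F_d$ such that - $X(f)\cap Y(f)=\varnothing$; - for every $n\ge1$, $X(f)$ contains no point $z$ with $f_\infty^n(z)=z$; - for every $n\ge1$, $Y(f)$ contains no point $z$ with $f_\infty^n(z)=z$. Moreover, the set $\Omega$ is non-empty. -/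

import Mathlib

open scoped LinearAlgebra.Projectivization

noncomputable section

namespace AttractingSets

/-- Complex projective space (more generally `ℙ K V`) carries the quotient topology. -/
instance projTopology {K V : Type*} [DivisionRing K] [AddCommGroup V] [Module K V]
    [TopologicalSpace V] : TopologicalSpace (ℙ K V) :=
  inferInstanceAs (TopologicalSpace (Quotient (projectivizationSetoid K V)))

/-- `CP n` is the projective space of `ℂⁿ`, of dimension `n - 1`,
with homogeneous coordinates `z₀, …, zₙ₋₁`. -/
abbrev CP (n : ℕ) : Type := ℙ ℂ (Fin n → ℂ)

/-- The map between projective spaces induced by a map `G` of vector spaces that is homogeneous of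
degree `d` and does not vanish outside the origin. -/
def projMap {m n : ℕ} (d : ℕ) (G : (Fin m → ℂ) → (Fin n → ℂ))
    (h0 : ∀ v, v ≠ 0 → G v ≠ 0) (hs : ∀ (t : ℂ) (v : Fin m → ℂ), G (t • v) = t ^ d • G v) :
    CP m → CP n :=
  Projectivization.lift (fun v => Projectivization.mk ℂ (G v) (h0 v v.2)) (by
    intro a b t h
    rw [Projectivization.mk_eq_mk_iff']
    exact ⟨t ^ d, by rw [h, hs]⟩)

/-- A homogeneous polynomial of degree `d` satisfies `p (t v) = t ^ d p v`. -/
theorem eval_smul_of_isHomogeneous {n d : ℕ} {p : MvPolynomial (Fin n) ℂ}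
    (hp : p.IsHomogeneous d) (t : ℂ) (v : Fin n → ℂ) :
    MvPolynomial.eval (t • v) p = t ^ d * MvPolynomial.eval v p := by
  rw [MvPolynomial.eval_eq, MvPolynomial.eval_eq, Finset.mul_sum]
  refine Finset.sum_congr rfl fun e he => ?_
  have hd : ∑ i ∈ e.support, e i = d := by
    have h1 := hp (MvPolynomial.mem_support_iff.mp he)
    have h2 := DFunLike.congr_fun (Finsupp.degree_eq_weight_one (σ := Fin n) (R := ℕ)) e
    rw [Finsupp.degree_apply] at h2
    exact h2.trans h1
  simp only [Pi.smul_apply, smul_eq_mul, mul_pow, Finset.prod_mul_distrib]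
  rw [Finset.prod_pow_eq_pow_sum, hd]
  ring

/-- The set `𝓕_d` (for the dimension `k`), with `d ≥ 2`: pairs `(f_∞, R)` where `R` is a homogeneous
polynomial of degree `d` in `k` variables and `f_∞ = (F₀, …, F_{k-1})` is a `k`-tuple of homogeneous
polynomials of degree `d` defining a holomorphic endomorphism of `ℙ^{k-1}` of degree `d`, that is,
without common zero outside the origin. -/
structure FamilyF (k d : ℕ) where
  F : Fin k → MvPolynomial (Fin k) ℂ
  R : MvPolynomial (Fin k) ℂ
  two_le : 2 ≤ d
  F_homogeneous : ∀ i, (F i).IsHomogeneous d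
  R_homogeneous : R.IsHomogeneous d
  F_nondegenerate : ∀ v : Fin k → ℂ, (∀ i, MvPolynomial.eval v (F i) = 0) → v = 0

namespace FamilyF

variable {k d : ℕ} (f : FamilyF k d)

/-- The polynomial map `ℂᵏ → ℂᵏ` with components `F₀, …, F_{k-1}`. -/
def FVec (v : Fin k → ℂ) : Fin k → ℂ := fun i => MvPolynomial.eval v (f.F i)

/-- The polynomial function `R` on `ℂᵏ`. -/
def RVal (v : Fin k → ℂ) : ℂ := MvPolynomial.eval v f.R

theorem FVec_ne_zero (v : Fin k → ℂ) (hv : v ≠ 0) : f.FVec v ≠ 0 :=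
  fun h => hv (f.F_nondegenerate v fun i => congrFun h i)

theorem FVec_smul (t : ℂ) (v : Fin k → ℂ) : f.FVec (t • v) = t ^ d • f.FVec v :=
  funext fun i => eval_smul_of_isHomogeneous (f.F_homogeneous i) t v

theorem RVal_smul (t : ℂ) (v : Fin k → ℂ) : f.RVal (t • v) = t ^ d * f.RVal v :=
  eval_smul_of_isHomogeneous f.R_homogeneous t v

/-- The endomorphism `f_∞` of `ℙ^{k-1}`. -/
def fInf : CP k → CP k := projMap d f.FVec f.FVec_ne_zero f.FVec_smul

/-- A representative of `[f_∞(z) : R(z)]`. -/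
def plusVec (v : Fin k → ℂ) : Fin (k + 1) → ℂ := Fin.snoc (α := fun _ => ℂ) (f.FVec v) (f.RVal v)

theorem plusVec_ne_zero (v : Fin k → ℂ) (hv : v ≠ 0) : f.plusVec v ≠ 0 := by
  intro h
  refine f.FVec_ne_zero v hv (funext fun i => ?_)
  simpa [plusVec] using congrFun h i.castSucc

theorem plusVec_smul (t : ℂ) (v : Fin k → ℂ) : f.plusVec (t • v) = t ^ d • f.plusVec v := by
  funext i
  refine Fin.lastCases ?_ (fun j => ?_) i
  · simp [plusVec, RVal_smul]
  · simp [plusVec, FVec_smul]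

/-- The map `f_∞⁺ : ℙ^{k-1} → ℙ^k`, `z ↦ [f_∞(z) : R(z)]`. -/
def fPlus : CP k → CP (k + 1) := projMap d f.plusVec f.plusVec_ne_zero f.plusVec_smul

/-- A representative of `[f_∞(z') : z_k ^ d + ε R(z')]`. -/
def epsVec (ε : ℂ) (v : Fin (k + 1) → ℂ) : Fin (k + 1) → ℂ :=
  Fin.snoc (α := fun _ => ℂ) (f.FVec (Fin.init v))
    (v (Fin.last k) ^ d + ε * f.RVal (Fin.init v))

theorem epsVec_ne_zero (ε : ℂ) (v : Fin (k + 1) → ℂ) (hv : v ≠ 0) : f.epsVec ε v ≠ 0 := by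
  intro h
  have hd : d ≠ 0 := by have := f.two_le; omega
  have h1 : Fin.init (α := fun _ => ℂ) v = 0 := by
    by_contra hne
    refine f.FVec_ne_zero _ hne (funext fun i => ?_)
    simpa [epsVec] using congrFun h i.castSucc
  have hR : f.RVal 0 = 0 := by simpa [hd] using f.RVal_smul 0 0
  have h2 : v (Fin.last k) = 0 := by
    have := congrFun h (Fin.last k)
    simpa [epsVec, h1, hR, hd] using this
  refine hv (funext fun i => ?_)
  refine Fin.lastCases h2 (fun j => ?_) i
  exact congrFun h1 j

theorem epsVec_smul (ε t : ℂ) (v : Fin (k + 1) → ℂ) :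
    f.epsVec ε (t • v) = t ^ d • f.epsVec ε v := by
  have h : Fin.init (α := fun _ => ℂ) (t • v) = t • Fin.init (α := fun _ => ℂ) v := rfl
  funext i
  refine Fin.lastCases ?_ (fun j => ?_) i
  · simp [epsVec, h, RVal_smul, mul_pow]
    ring
  · simp [epsVec, h, FVec_smul]

/-- The endomorphism `f_ε` of `ℙ^k`, `[z' : z_k] ↦ [f_∞(z') : z_k ^ d + ε R(z')]`. -/
def fEps (ε : ℂ) : CP (k + 1) → CP (k + 1) :=
  projMap d (f.epsVec ε) (f.epsVec_ne_zero ε) (f.epsVec_smul ε)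

end FamilyF

/-- The multiplicity (local degree) of a map `g` at `x`: the maximal number of preimages, in an
arbitrarily small neighbourhood of `x`, of one point. For a finite holomorphic map between complex
manifolds of the same dimension, `x` has a basis of neighbourhoods `U` on which `g` is a branched
covering of some fixed degree `m` onto its image; generic fibres in `U` then have `m` points and all
fibres in `U` have at most `m` points, so that this is the usual multiplicity `m`. -/
def localMultiplicity {α β : Type*} [TopologicalSpace α] (g : α → β) (x : α) : ℕ∞ :=
  ⨅ U ∈ nhds x, ⨆ w : β, (U ∩ g ⁻¹' {w}).encard

namespace FamilyF

variable {k d : ℕ} (f : FamilyF k d)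

/-- The cardinality of the fibre `(f_∞⁺)⁻¹(f_∞⁺(z))`, which is a subset of the finite set
`f_∞⁻¹(f_∞(z))`; each point `z'` is counted with its multiplicity as a preimage under `f_∞`. -/
def fibreCount (z : CP k) : ℕ∞ :=
  ∑ᶠ z' ∈ f.fPlus ⁻¹' {f.fPlus z}, localMultiplicity f.fInf z'

/-- `X₋₁(f)`; note `s - 1 = k - 2`. -/
def XNegOne : Set (CP k) := {z | ((d ^ (k - 2) + 1 : ℕ) : ℕ∞) ≤ f.fibreCount z}

/-- `X(f) = f_∞(X₋₁(f))`. -/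
def X : Set (CP k) := f.fInf '' f.XNegOne

/-- `Y₋₂(f)`. The condition `f ∘ f_∞⁺(z) = f ∘ f_∞⁺(z')`, for points with `f_∞(z) = f_∞(z')`, is the
same for all the maps `f_ε` (if `z, z'` are lifted to vectors with the same image under `f_∞`,
it says `R(z) ^ d = R(z') ^ d`), and is written here with `ε = 1`. -/
def YNegTwo : Set (CP k) :=
  {z | f.RVal z.rep = 0} ∪
  {z | ∃ z' : CP k, f.fPlus z ≠ f.fPlus z' ∧ f.fInf z = f.fInf z' ∧
    f.fEps 1 (f.fPlus z) = f.fEps 1 (f.fPlus z')}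

/-- `Y(f) = f_∞²(Y₋₂(f))`. -/
def Y : Set (CP k) := f.fInf^[2] '' f.YNegTwo

/-- `Z(f) = X(f) ∪ Y(f)`. -/
def Z : Set (CP k) := f.X ∪ f.Y

end FamilyF

/-- The set `Ω ⊆ 𝓕_d`: pairs such that `X(f)` and `Y(f)` are disjoint and
`⋂_{i=0}^{n} f_∞^{-i}(Z(f)) = ∅` for some `n`. -/
def Omega (k d : ℕ) : Set (FamilyF k d) :=
  {f | f.X ∩ f.Y = ∅ ∧ ∃ n : ℕ, (⋂ i ∈ Finset.range (n + 1), f.fInf^[i] ⁻¹' f.Z) = ∅}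

end AttractingSets

end

namespace AttractingSets

/-! The example is generic: `f_∞` is `v ↦ A v^d` and `R = mixedForm d t + a ⬝ᵥ v^d`, where all
entries of `t`, `A`, `a` are algebraically independent over `ℚ`. Each claim becomes a count of
transcendence degrees, computed as ranks in the algebraic matroid of `ℂ`.

Fibres of `f_∞` are obtained by multiplying coordinates by `d`-th roots of unity, and the term in
`a` is constant on them. A fibre of `f_∞⁺` large enough to define `X` imposes so many linear
relations on a row of `t` that its points must be algebraic over `t` (`exists_of_mem_X`). A point
`c` of `Y₋₂` instead makes `a ⬝ᵥ c^d` algebraic over `t` and `c` (`dotProduct_mem_of_mem_YNegTwo`).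
As `a` is independent of `t` and `A`, no point algebraic over `t` and `A` lies in `Y`. This covers
the points of `X`, their images, and all periodic points, which are algebraic over `A`
(`mem_algClosureOf_of_periodic`). A periodic point in `X` would give a polynomial identity in the
entries of `A`, refuted by a rank-one matrix (`powMap_iterate_ne_smul`).

For `Ω`, the image of a point of `X` leaves `Z`, so a long orbit in `Z` lies in `Y` except possibly
at its end. If its starting point `v` adds `τ ≤ k` to the transcendence degree of `(t, A)`, then `τ
+ 1` successive points of the orbit are linearly independent, even after twisting by roots of unity.
They impose `τ + 1` independent linear conditions on `a`, one more than `v` has parameters to absorb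
(`not_forall_exists_powMap_powMap`). -/

/-- The algebraic closure in `ℂ` of the field generated by `S`. -/
noncomputable def algClosureOf (S : Set ℂ) : Subfield ℂ :=
  { (Subalgebra.algebraicClosure (Algebra.adjoin ℚ S) ℂ).toSubring with
    inv_mem' := fun _ hx => IsAlgebraic.inv hx }

/-- The matroid of algebraic independence over `ℚ` on `ℂ`. -/
noncomputable abbrev algMatroid : Matroid ℂ := AlgebraicIndependent.matroid ℚ ℂ

/-! ### Algebraic closure and transcendence degree inside `ℂ`. -/

section AlgClosureOf

variable {S T : Set ℂ}

theorem coe_algClosureOf (S : Set ℂ) : (algClosureOf S : Set ℂ) = algMatroid.closure S :=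
  (AlgebraicIndependent.matroid_closure_eq (R := ℚ) (A := ℂ) (s := S)).symm

theorem mem_algClosureOf_iff {x : ℂ} : x ∈ algClosureOf S ↔ x ∈ algMatroid.closure S := by
  rw [← coe_algClosureOf]; rfl

theorem subset_algClosureOf (S : Set ℂ) : S ⊆ algClosureOf S := by
  rw [coe_algClosureOf]
  exact Matroid.subset_closure _ _ (Set.subset_univ _)

theorem algClosureOf_le (h : S ⊆ algClosureOf T) : algClosureOf S ≤ algClosureOf T := by
  rw [coe_algClosureOf] at h
  rw [← SetLike.coe_subset_coe, coe_algClosureOf, coe_algClosureOf]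
  exact Matroid.closure_subset_closure_of_subset_closure h

theorem algClosureOf_mono (h : S ⊆ T) : algClosureOf S ≤ algClosureOf T :=
  algClosureOf_le (h.trans (subset_algClosureOf T))

theorem mem_algClosureOf_of_pow {x : ℂ} {n : ℕ} (hn : n ≠ 0) (h : x ^ n ∈ algClosureOf S) :
    x ∈ algClosureOf S :=
  IsAlgebraic.of_pow (Nat.pos_of_ne_zero hn) h

theorem mem_algClosureOf_of_pow_eq_one {x : ℂ} {n : ℕ} (hn : n ≠ 0) (h : x ^ n = 1) :
    x ∈ algClosureOf S :=
  mem_algClosureOf_of_pow hn (h ▸ one_mem _)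

theorem mem_algClosureOf_of_isAlgebraic {x : ℂ} (h : IsAlgebraic (algClosureOf S) x) :
    x ∈ algClosureOf S := by
  have hflat := Matroid.isFlat_closure (M := algMatroid) S
  obtain ⟨B, hB, hB'⟩ := AlgebraicIndependent.matroid_isFlat_iff.mp hflat
  rw [mem_algClosureOf_iff]
  refine hB' x ?_
  have hBS : (B : Set ℂ) = algClosureOf S := by rw [hB, coe_algClosureOf]
  obtain ⟨q, hq, hqx⟩ := h
  have hmem : ∀ y : algClosureOf S, (y : ℂ) ∈ B := fun y => by
    rw [← SetLike.mem_coe, hBS]; exact y.2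
  let φ : algClosureOf S →+* B := (algClosureOf S).subtype.codRestrict B hmem
  refine ⟨q.map φ, (Polynomial.map_ne_zero_iff (fun a b hab => ?_)).mpr hq, ?_⟩
  · exact Subtype.ext (congrArg (fun z : B => (z : ℂ)) hab)
  · rw [Polynomial.aeval_def, Polynomial.eval₂_map]
    rw [Polynomial.aeval_def] at hqx
    exact hqx

theorem eRk_le_of_subset (h : S ⊆ algClosureOf T) : algMatroid.eRk S ≤ algMatroid.eRk T := by
  rw [← Matroid.eRk_closure_eq _ T, ← coe_algClosureOf]
  exact Matroid.eRk_mono _ h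

theorem eRk_union_range_le {κ : Type*} [Fintype κ] (q : κ → ℂ) :
    algMatroid.eRk (S ∪ Set.range q) ≤ algMatroid.eRk S + Fintype.card κ := by
  refine (Matroid.eRk_union_le_eRk_add_encard _ _ _).trans ?_
  gcongr
  rw [← Set.image_univ]
  exact (Set.encard_image_le _ _).trans (by simp)

/-- A finite system `xᵢ ^ d ∈ span (x)` with `d ≥ 2` has only algebraic solutions. -/
theorem mem_algClosureOf_of_pow_mem_span {ι : Type*} [Finite ι] {d : ℕ} (hd : 2 ≤ d) (x : ι → ℂ)
    (hx : ∀ i, x i ^ d ∈ Submodule.span (algClosureOf S) (Set.range x)) (i : ι) :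
    x i ∈ algClosureOf S := by
  by_contra hi
  have : IsIntegrallyClosedIn (algClosureOf S).toSubring ℂ := by
    rw [Subring.isIntegrallyClosedIn_iff]
    intro y hy
    exact mem_algClosureOf_of_isAlgebraic (S := S) (IsIntegral.isAlgebraic hy)
  -- An algebraically closed subfield is the intersection of the valuation rings above it. For a
  -- valuation with `x i` non-integral, a coordinate `x m` of maximal value exceeds 1, yet its
  -- `d`-th power is bounded by the value of `x m` itself.
  obtain ⟨V, hV, hiV⟩ :=
    Subring.exists_le_valuationSubring_of_isIntegrallyClosedIn (R := (algClosureOf S).toSubring) hi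
  have : Nonempty ι := ⟨i⟩
  obtain ⟨m, hm⟩ := Finite.exists_max fun j => V.valuation (x j)
  have h1 : 1 < V.valuation (x m) := by
    refine lt_of_lt_of_le ?_ (hm i)
    rw [← not_le, V.valuation_le_one_iff]
    exact hiV
  have h2 : ∀ y ∈ Submodule.span (algClosureOf S) (Set.range x),
      V.valuation y ≤ V.valuation (x m) := by
    intro y hy
    induction hy using Submodule.span_induction with
    | mem y hy => obtain ⟨j, rfl⟩ := hy; exact hm j
    | zero => simp
    | add y z _ _ hy hz => exact (V.valuation.map_add y z).trans (max_le hy hz)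
    | smul c y _ hy =>
      have hc : V.valuation (c : ℂ) ≤ 1 := (V.valuation_le_one_iff _).mpr (hV c.2)
      rw [Subfield.smul_def, smul_eq_mul, map_mul]
      exact (mul_le_mul' hc hy).trans (one_mul _).le
  have h3 := h2 _ (hx m)
  rw [map_pow] at h3
  have h4 : V.valuation (x m) ^ 1 < V.valuation (x m) ^ d := pow_lt_pow_right₀ h1 (by omega)
  rw [pow_one] at h4
  exact absurd h3 (not_le.mpr h4)

end AlgClosureOf

theorem exists_algebraicIndependent_complex (ι : Type) [Finite ι] :
    ∃ p : ι → ℂ, AlgebraicIndependent ℚ p := by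
  obtain ⟨s, hs⟩ := exists_isTranscendenceBasis ℚ ℂ
  have h := IsAlgClosed.cardinal_eq_cardinal_transcendence_basis_of_aleph0_lt' _ hs (by simp)
    (by rw [Cardinal.mk_complex]; exact Cardinal.aleph0_lt_continuum)
  have hinf : Infinite s := by
    rw [Cardinal.infinite_iff, ← h, Cardinal.mk_complex]
    exact Cardinal.aleph0_le_continuum
  obtain ⟨n, ⟨e⟩⟩ := Finite.exists_equiv_fin ι
  let g : ι → s := fun i => Infinite.natEmbedding s (e i)
  have hg : Function.Injective g :=
    (Infinite.natEmbedding s).injective.comp (Fin.val_injective.comp e.injective)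
  exact ⟨fun i => (g i : ℂ), hs.1.comp g hg⟩

/-! ### Counting with algebraically independent families. -/

section Generic

variable {ι : Type} {p : ι → ℂ} {S : Set ℂ}

theorem card_le_eRk_of_algebraicIndependent [Fintype ι] (hp : AlgebraicIndependent ℚ p)
    (h : Set.range p ⊆ algClosureOf S) : (Fintype.card ι : ℕ∞) ≤ algMatroid.eRk S := by
  have hI : algMatroid.Indep (Set.range p) := hp.coe_range
  refine le_trans ?_ (eRk_le_of_subset h)
  rw [hI.eRk_eq_encard, ← Set.image_univ, hp.injective.encard_image]
  simp

/-- An exchange argument: if as few parameters as `p` has members already determine `p`, then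
conversely `p` determines them. -/
theorem algClosureOf_le_of_eRk_le [Fintype ι] (hp : AlgebraicIndependent ℚ p)
    (h : Set.range p ⊆ algClosureOf S) (hS : algMatroid.eRk S ≤ Fintype.card ι) :
    algClosureOf S ≤ algClosureOf (Set.range p) := by
  have hI : algMatroid.Indep (Set.range p) := hp.coe_range
  have h2 : (Fintype.card ι : ℕ∞) = algMatroid.eRk (Set.range p) := by
    rw [hI.eRk_eq_encard, ← Set.image_univ, hp.injective.encard_image]
    simp
  have h3 := Matroid.IsRkFinite.closure_eq_closure_of_subset_of_eRk_ge_eRk (M := algMatroid)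
    (X := Set.range p) (Y := algMatroid.closure S) ?_ (by rwa [← coe_algClosureOf]) ?_
  · rw [Matroid.closure_closure] at h3
    rw [← SetLike.coe_subset_coe, coe_algClosureOf, coe_algClosureOf, h3]
  · exact Matroid.isRkFinite_of_finite _ (Set.finite_range p)
  · rw [Matroid.eRk_closure_eq, ← h2]
    exact hS

theorem notMem_algClosureOf (hp : AlgebraicIndependent ℚ p) (i : ι) :
    p i ∉ algClosureOf (p '' {i}ᶜ) :=
  (AlgebraicIndependent.iff_transcendental_adjoin_image i).mp hp |>.2

/-- Independence over `ℚ(p)` persists over its algebraic closure; this licenses specialising `q`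
arbitrarily in an identity with coefficients algebraic over `p`. -/
theorem eq_zero_of_aeval_eq_zero {τ : Type} {q : τ → ℂ}
    (h : AlgebraicIndependent ℚ (Sum.elim p q))
    (P : MvPolynomial τ (algClosureOf (Set.range p))) (hP : MvPolynomial.aeval q P = 0) :
    P = 0 := by
  have h1 : AlgebraicIndependent ℚ (Sum.elim q p) := by
    have := h.comp (Equiv.sumComm τ ι) (Equiv.sumComm τ ι).injective
    convert! this using 1
    ext (i | i) <;> rfl
  have h2 := (AlgebraicIndependent.sumElim_iff.mp h1).2.subalgebraAlgebraicClosure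
  exact (injective_iff_map_eq_zero _).mp h2 P hP

end Generic

/-! ### Linear conditions defined over a subfield. -/

section LinearAlgebra

variable {k r : ℕ} (C : Subfield ℂ)

theorem linearIndependent_subfield_lift (g : Fin r → Fin k → ℂ) (hg : LinearIndependent ℂ g)
    (g' : Fin r → Fin k → C) (hgg : ∀ i j, (g' i j : ℂ) = g i j) : LinearIndependent C g' := by
  let φ : (Fin k → C) →ₗ[C] (Fin k → ℂ) :=
    LinearMap.pi fun j => (Algebra.linearMap C ℂ).comp (LinearMap.proj j)
  have h1 : LinearIndependent C g := hg.restrict_scalars (by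
    intro x y hxy
    simpa [Subfield.smul_def] using hxy)
  have h2 : ⇑φ ∘ g' = g := by
    funext i j
    exact hgg i j
  exact LinearIndependent.of_comp φ (h2 ▸ h1)

/-- If `W` spans together with some coordinate vectors, a vector is defined over `C` once its
pairings with `W` and the corresponding coordinates are. -/
theorem exists_coordinates_determine (g : Fin r → Fin k → ℂ) (hgC : ∀ i j, g i j ∈ C)
    (hg : LinearIndependent ℂ g) :
    ∃ J : Finset (Fin k), J.card + r = k ∧ ∀ C' : Subfield ℂ, C ≤ C' → ∀ x : Fin k → ℂ,
      (∀ i, x ⬝ᵥ g i ∈ C') → (∀ j ∈ J, x j ∈ C') → ∀ j, x j ∈ C' := by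
  classical
  let g' : Fin r → Fin k → C := fun i j => ⟨g i j, hgC i j⟩
  have hg' := linearIndependent_subfield_lift C g hg g' fun _ _ => rfl
  -- The classes of the coordinate vectors span the quotient by `W`; `J` indexes those forming a
  -- basis of it.
  let W := Submodule.span C (Set.range g')
  let e : Fin k → (Fin k → C) ⧸ W := fun j => W.mkQ (Pi.single j 1)
  obtain ⟨κ, c, hc, hspan, hli⟩ := exists_linearIndependent' C e
  have htop : Submodule.span C (Set.range e) = ⊤ := by
    have : Set.range e = W.mkQ '' Set.range fun j : Fin k => (Pi.single j 1 : Fin k → C) := by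
      rw [← Set.range_comp]; rfl
    rw [this, ← Submodule.map_span]
    have hb := (Pi.basisFun C (Fin k)).span_eq
    have h2 : Set.range (Pi.basisFun C (Fin k)) =
        Set.range fun j : Fin k => (Pi.single j 1 : Fin k → C) := by
      congr 1; funext j; simp
    rw [← h2, hb, Submodule.map_top, Submodule.range_mkQ]
  have : Finite κ := Finite.of_injective c hc
  have := Fintype.ofFinite κ
  refine ⟨Finset.univ.image c, ?_, fun C' hC x hx hxJ => ?_⟩
  · rw [Finset.card_image_of_injective _ hc, Finset.card_univ]
    have h1 : Module.finrank C W = r := by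
      rw [finrank_span_eq_card hg', Fintype.card_fin]
    have h2 : Module.finrank C ((Fin k → C) ⧸ W) = Fintype.card κ := by
      rw [← finrank_span_eq_card hli, hspan, htop, finrank_top]
    have h3 := Submodule.finrank_quotient_add_finrank W
    rw [h1, h2, Module.finrank_fintype_fun_eq_card, Fintype.card_fin] at h3
    exact h3
  -- The vectors over `C` whose pairing with `x` lies in `C'` form a subspace containing `W` and the
  -- coordinate vectors from `J`, hence everything.
  · let L : Submodule C (Fin k → C) :=
      { carrier := {y | x ⬝ᵥ (fun j => (y j : ℂ)) ∈ C'}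
        add_mem' := fun {y z} hy hz => by
          have h1 : x ⬝ᵥ (fun j => (y j : ℂ)) ∈ C' := hy
          have h2 : x ⬝ᵥ (fun j => (z j : ℂ)) ∈ C' := hz
          have := add_mem h1 h2
          rw [← dotProduct_add] at this
          exact this
        zero_mem' := by
          have : x ⬝ᵥ (fun j => ((0 : Fin k → C) j : ℂ)) = 0 := by simp [dotProduct]
          exact (congrArg (· ∈ C') this).mpr (zero_mem _)
        smul_mem' := fun α y hy => by
          have h1 : x ⬝ᵥ (fun j => (y j : ℂ)) ∈ C' := hy
          have := mul_mem (hC α.2) h1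
          rw [← smul_eq_mul, ← dotProduct_smul] at this
          exact this }
    have hW : W ≤ L := by
      rw [Submodule.span_le]
      rintro _ ⟨i, rfl⟩
      exact hx i
    have hsingle : ∀ j, Pi.single j 1 ∈ L ↔ x j ∈ C' := fun j => by
      have : x ⬝ᵥ (fun i => ((Pi.single j 1 : Fin k → C) i : ℂ)) = x j := by
        rw [dotProduct, Finset.sum_eq_single j]
        · simp
        · intro i _ hi
          simp [Pi.single_eq_of_ne hi]
        · simp
      change x ⬝ᵥ (fun i => ((Pi.single j 1 : Fin k → C) i : ℂ)) ∈ C' ↔ _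
      rw [this]
    have hL : L = ⊤ := by
      have h1 : L.map W.mkQ = ⊤ := by
        rw [eq_top_iff, ← htop, ← hspan, Submodule.span_le]
        rintro _ ⟨i, rfl⟩
        exact ⟨Pi.single (c i) 1, (hsingle _).mpr (hxJ _ (by simp)), rfl⟩
      have h2 := congrArg (Submodule.comap W.mkQ) h1
      rw [Submodule.comap_map_mkQ, Submodule.comap_top, sup_eq_right.mpr hW] at h2
      exact h2
    intro j
    rw [← hsingle, hL]
    trivial

theorem mem_of_mulVec_mem {A : Matrix (Fin k) (Fin k) ℂ} (hA : ∀ i j, A i j ∈ C)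
    (hdet : A.det ≠ 0) {h : Fin k → ℂ} (hh : ∀ i, A.mulVec h i ∈ C) (i : Fin k) : h i ∈ C := by
  have hli : LinearIndependent ℂ A := Matrix.linearIndependent_rows_of_det_ne_zero hdet
  obtain ⟨J, hJ, H⟩ := exists_coordinates_determine C A hA hli
  have hJ0 : J = ∅ := by rw [← Finset.card_eq_zero]; omega
  refine H C le_rfl h (fun i => ?_) (by simp [hJ0]) i
  rw [dotProduct_comm]
  exact hh i

theorem mulVec_mem {A : Matrix (Fin k) (Fin k) ℂ} (hA : ∀ i j, A i j ∈ C)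
    {h : Fin k → ℂ} (hh : ∀ i, h i ∈ C) (i : Fin k) : A.mulVec h i ∈ C := by
  rw [Matrix.mulVec, dotProduct]
  exact sum_mem fun j _ => mul_mem (hA i j) (hh j)

end LinearAlgebra

/-! ### Linear independence along generic orbits of `v ↦ A v^d`. -/

section Dynamics

variable {k d : ℕ}

/-- The set of entries of a square matrix. -/
def entries (M : Matrix (Fin k) (Fin k) ℂ) : Set ℂ := Set.range fun ij : Fin k × Fin k => M ij.1 ij.2

theorem mem_entries (M : Matrix (Fin k) (Fin k) ℂ) (i j : Fin k) : M i j ∈ entries M := ⟨(i, j), rfl⟩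

theorem eRk_entries_le (M : Matrix (Fin k) (Fin k) ℂ) : algMatroid.eRk (entries M) ≤ (k * k : ℕ) := by
  have := eRk_union_range_le (S := ∅) fun ij : Fin k × Fin k => M ij.1 ij.2
  simpa [entries] using this

/-- The polynomial map `v ↦ A (v₀ᵈ, …, vₛᵈ)`. -/
def powMap {R : Type*} [CommSemiring R] (d : ℕ) (A : Matrix (Fin k) (Fin k) R) (v : Fin k → R) :
    Fin k → R := A.mulVec (v ^ d)

theorem map_powMap {R R' : Type*} [CommSemiring R] [CommSemiring R'] (φ : R →+* R')
    (A : Matrix (Fin k) (Fin k) R) (v : Fin k → R) :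
    φ ∘ powMap d A v = powMap d (A.map φ) (φ ∘ v) := by
  funext i
  simp [powMap, Matrix.mulVec, dotProduct]

theorem map_powMap_iterate {R R' : Type*} [CommSemiring R] [CommSemiring R'] (φ : R →+* R')
    (A : Matrix (Fin k) (Fin k) R) (v : Fin k → R) (n : ℕ) :
    φ ∘ (powMap d A)^[n] v = (powMap d (A.map φ))^[n] (φ ∘ v) := by
  induction n with
  | zero => rfl
  | succ n ih => rw [Function.iterate_succ_apply', Function.iterate_succ_apply', map_powMap, ih]

theorem powMap_smul (A : Matrix (Fin k) (Fin k) ℂ) (c : ℂ) (v : Fin k → ℂ) :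
    powMap d A (c • v) = c ^ d • powMap d A v := by
  rw [powMap, smul_pow, Matrix.mulVec_smul, powMap]

theorem powMap_iterate_smul (A : Matrix (Fin k) (Fin k) ℂ) (c : ℂ) (v : Fin k → ℂ) (n : ℕ) :
    (powMap d A)^[n] (c • v) = c ^ d ^ n • (powMap d A)^[n] v := by
  induction n with
  | zero => simp
  | succ n ih =>
    rw [Function.iterate_succ_apply', Function.iterate_succ_apply', ih, powMap_smul, ← pow_mul,
      pow_succ]

theorem powMap_eq_powMap_iff {A : Matrix (Fin k) (Fin k) ℂ} (hA : A.det ≠ 0) {v w : Fin k → ℂ} :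
    powMap d A v = powMap d A w ↔ v ^ d = w ^ d :=
  (Matrix.mulVec_injective_of_isUnit
    ((Matrix.isUnit_iff_isUnit_det A).mpr (isUnit_iff_ne_zero.mpr hA))).eq_iff

theorem powMap_mem {C : Subfield ℂ} {A : Matrix (Fin k) (Fin k) ℂ} (hA : ∀ i j, A i j ∈ C)
    {v : Fin k → ℂ} (hv : ∀ i, v i ∈ C) (i : Fin k) : powMap d A v i ∈ C :=
  mulVec_mem C hA (fun j => pow_mem (hv j) d) i

theorem mem_of_powMap_mem {S : Set ℂ} {A : Matrix (Fin k) (Fin k) ℂ}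
    (hA : ∀ i j, A i j ∈ algClosureOf S) (hdet : A.det ≠ 0) (hd : d ≠ 0)
    {v : Fin k → ℂ} (hv : ∀ i, powMap d A v i ∈ algClosureOf S) (i : Fin k) :
    v i ∈ algClosureOf S :=
  mem_algClosureOf_of_pow hd (mem_of_mulVec_mem _ hA hdet hv i)

theorem powMap_ne_zero {A : Matrix (Fin k) (Fin k) ℂ} (hA : A.det ≠ 0) (hd : d ≠ 0)
    {v : Fin k → ℂ} (hv : v ≠ 0) : powMap d A v ≠ 0 := by
  intro h
  have h0 : powMap d A v = powMap d A 0 := by rw [h, powMap, zero_pow hd, Matrix.mulVec_zero]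
  rw [powMap_eq_powMap_iff hA, zero_pow hd] at h0
  exact hv (by simpa [hd] using h0)

/-- If an orbit (up to roots of unity) of `v ↦ A vᵈ` becomes linearly dependent after `j` steps,
then the transcendence degree of the pair `(A, v)` is small. -/
theorem eRk_add_one_le_of_dependent (S : Set ℂ) (A : Matrix (Fin k) (Fin k) ℂ) (hd : d ≠ 0)
    (v β : ℕ → Fin k → ℂ) (hv : ∀ i, v (i + 1) = powMap d A (v i)) (hβ : ∀ i, β i ^ d = v i ^ d)
    (i₀ : Fin k) (h1 : v 0 i₀ = 1) (j : ℕ) (hj : 1 ≤ j)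
    (hli : LinearIndependent ℂ fun i : Fin j => v i ^ d)
    (hspan : β j ∈ Submodule.span ℂ (Set.range fun i : Fin j => β i)) :
    algMatroid.eRk (S ∪ entries A ∪ Set.range (v 0)) + 1 ≤ algMatroid.eRk S + (k * k + j : ℕ) := by
  obtain ⟨c, hc⟩ := (Submodule.mem_span_range_iff_exists_fun ℂ).mp hspan
  -- The parameters, in order: `k - 1` coordinates of `β 0` (the remaining one is a root of unity),
  -- the vectors `β 1, …, β (j-1)`, and the `j` coefficients expressing `β j`. They determine `v 0,
  -- …, v j`. Since `A` sends the `j` independent vectors `v i ^ d` to `v (i+1)`, only `k (k - j)`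
  -- of its entries remain free.
  let U₁ := S ∪ Set.range fun i : {i // i ≠ i₀} => β 0 i
  let U₂ := U₁ ∪ Set.range fun li : Fin (j - 1) × Fin k => β (li.1 + 1) li.2
  let U₃ := U₂ ∪ Set.range c
  have hsub := subset_algClosureOf U₃
  have hpow : ∀ i x, β i x ^ d = v i x ^ d := fun i x => congrFun (hβ i) x
  have hβ0 : ∀ x, β 0 x ∈ algClosureOf U₃ := by
    intro x
    by_cases hx : x = i₀
    · refine mem_algClosureOf_of_pow_eq_one hd ?_
      rw [hpow, hx, h1, one_pow]
    · exact hsub (Or.inl (Or.inl (Or.inr ⟨⟨x, hx⟩, rfl⟩)))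
  have hβlt : ∀ i < j, ∀ x, β i x ∈ algClosureOf U₃ := by
    intro i hi x
    rcases i with _ | i
    · exact hβ0 x
    · exact hsub (Or.inl (Or.inr ⟨(⟨i, by omega⟩, x), rfl⟩))
  have hβj : ∀ x, β j x ∈ algClosureOf U₃ := by
    intro x
    rw [← hc, Finset.sum_apply]
    exact sum_mem fun i _ => mul_mem (hsub (Or.inr ⟨i, rfl⟩)) (hβlt i i.2 x)
  have hvle : ∀ i ≤ j, ∀ x, v i x ∈ algClosureOf U₃ := by
    intro i hi x
    refine mem_algClosureOf_of_pow hd ?_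
    rw [← hpow]
    refine pow_mem ?_ d
    rcases hi.lt_or_eq with h | rfl
    · exact hβlt i h x
    · exact hβj x
  obtain ⟨J, hJ, H⟩ := exists_coordinates_determine (algClosureOf U₃) (fun i : Fin j => v i ^ d)
    (fun i x => pow_mem (hvle i i.2.le x) d) hli
  let U₄ := U₃ ∪ Set.range fun mj : Fin k × J => A mj.1 mj.2
  have hU : algClosureOf U₃ ≤ algClosureOf U₄ := algClosureOf_mono Set.subset_union_left
  have hA : ∀ m x, A m x ∈ algClosureOf U₄ := by
    intro m
    refine H _ hU (A m) (fun i => ?_) fun x hx => ?_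
    · have : A m ⬝ᵥ v i ^ d = v (i + 1) m := by rw [hv]; rfl
      rw [this]
      exact hU (hvle _ (by omega) m)
    · exact subset_algClosureOf U₄ (Or.inr ⟨(m, ⟨x, hx⟩), rfl⟩)
  have hfin : S ∪ entries A ∪ Set.range (v 0) ⊆ algClosureOf U₄ := by
    rintro x ((hx | ⟨ij, rfl⟩) | ⟨i, rfl⟩)
    · exact hU (hsub (Or.inl (Or.inl (Or.inl hx))))
    · exact hA _ _
    · exact hU (hvle 0 (Nat.zero_le j) i)
  have hcount : algMatroid.eRk U₄ ≤
      algMatroid.eRk S + (k - 1 : ℕ) + ((j - 1) * k : ℕ) + j + (k * J.card : ℕ) := by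
    refine (eRk_union_range_le _).trans ?_
    refine add_le_add ((eRk_union_range_le _).trans ?_) (by simp)
    refine add_le_add ((eRk_union_range_le _).trans ?_) (by simp)
    refine add_le_add ((eRk_union_range_le _).trans ?_) (by simp)
    refine add_le_add le_rfl ?_
    simp [Fintype.card_subtype_compl]
  have harith : k - 1 + (j - 1) * k + j + k * J.card + 1 = k * k + j := by
    obtain ⟨j, rfl⟩ : ∃ i, j = i + 1 := ⟨j - 1, by omega⟩
    have : k - 1 + 1 = k := by have := i₀.2; omega
    rw [Nat.add_sub_cancel]
    calc k - 1 + j * k + (j + 1) + k * J.card + 1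
        = (k - 1 + 1) + j * k + (j + 1) + k * J.card := by ring
      _ = k * (J.card + (j + 1)) + (j + 1) := by rw [this]; ring
      _ = _ := by rw [hJ]
  refine (add_le_add_left ((eRk_le_of_subset hfin).trans hcount) 1).trans ?_
  rw [← harith]
  push_cast
  simp only [add_assoc, le_refl]

theorem linearIndependent_of_mulVec {ι : Type*} (A : Matrix (Fin k) (Fin k) ℂ)
    (h : ι → Fin k → ℂ) (hA : LinearIndependent ℂ fun i => A.mulVec (h i)) :
    LinearIndependent ℂ h :=
  LinearIndependent.of_comp A.mulVecLin hA

/-- The pair `(A, v)` has transcendence degree at least `k ^ 2 + τ` over `S`,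
and some coordinate of `v` is `1`. -/
def IsGenericPoint (S : Set ℂ) (A : Matrix (Fin k) (Fin k) ℂ) (τ : ℕ) (v : Fin k → ℂ) : Prop :=
  (∃ i, v i = 1) ∧
    algMatroid.eRk S + (k * k + τ : ℕ) ≤ algMatroid.eRk (S ∪ entries A ∪ Set.range v)

variable {S : Set ℂ} {A : Matrix (Fin k) (Fin k) ℂ} {τ : ℕ}

/-- Genericity passes to the renormalised image because the step can be undone algebraically: `A`
and `c • powMap d A v` determine `μ • v` with `μ ^ d = c`, and the coordinate of `v` equal to 1 then
reveals `μ`. -/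
theorem IsGenericPoint.exists_smul_powMap (hA : A.det ≠ 0) (hd : d ≠ 0) {v : Fin k → ℂ}
    (hv : IsGenericPoint S A τ v) : ∃ c : ℂ, c ≠ 0 ∧ IsGenericPoint S A τ (c • powMap d A v) := by
  obtain ⟨⟨i₀, hi₀⟩, hτ⟩ := hv
  have hv0 : v ≠ 0 := fun h => by simp [h] at hi₀
  obtain ⟨i₁, hi₁⟩ := Function.ne_iff.mp (powMap_ne_zero hA hd hv0)
  let c := (powMap d A v i₁)⁻¹
  have hc : c ≠ 0 := inv_ne_zero hi₁
  refine ⟨c, hc, ⟨i₁, inv_mul_cancel₀ hi₁⟩, hτ.trans (eRk_le_of_subset ?_)⟩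
  have hsub := subset_algClosureOf (S ∪ entries A ∪ Set.range (c • powMap d A v))
  obtain ⟨μ, hμ⟩ := IsAlgClosed.exists_pow_nat_eq c (Nat.pos_of_ne_zero hd)
  have hμ0 : μ ≠ 0 := fun h => hc (by rw [← hμ, h, zero_pow hd])
  have hmem := mem_of_powMap_mem (S := S ∪ entries A ∪ Set.range (c • powMap d A v))
    (fun i j => hsub (Or.inl (Or.inr (mem_entries A i j)))) hA hd
    (v := μ • v) fun i => by
      rw [powMap_smul, hμ]
      exact hsub (Or.inr ⟨i, rfl⟩)
  have hμmem := hmem i₀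
  rw [Pi.smul_apply, hi₀, smul_eq_mul, mul_one] at hμmem
  rintro x (hx | ⟨i, rfl⟩)
  · exact hsub (Or.inl hx)
  · have := mul_mem (inv_mem hμmem) (hmem i)
    rwa [Pi.smul_apply, smul_eq_mul, inv_mul_cancel_left₀ hμ0] at this

/-- `A` maps these powers to the orbit of the image of `v`, which up to scalars is the orbit of
another generic point. -/
theorem IsGenericPoint.linearIndependent_pow (hA : A.det ≠ 0) (hd : d ≠ 0) {r : ℕ}
    (h : ∀ w, IsGenericPoint S A τ w → LinearIndependent ℂ fun i : Fin r => (powMap d A)^[i] w)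
    {v : Fin k → ℂ} (hv : IsGenericPoint S A τ v) :
    LinearIndependent ℂ fun i : Fin r => (powMap d A)^[i] v ^ d := by
  obtain ⟨c, hc, hcv⟩ := hv.exists_smul_powMap hA hd
  have h1 := h _ hcv
  refine linearIndependent_of_mulVec A _ ?_
  have h2 : (fun i : Fin r => (powMap d A)^[i] (c • powMap d A v)) =
      (fun i : Fin r => Units.mk0 c hc ^ d ^ (i : ℕ)) •
        fun i : Fin r => A.mulVec ((powMap d A)^[i] v ^ d) := by
    funext i
    rw [powMap_iterate_smul, Pi.smul_apply', ← Function.iterate_succ_apply,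
      Function.iterate_succ_apply']
    rfl
  rw [h2] at h1
  exact (LinearIndependent.units_smul_iff _ _).mp h1

/-- A dependence appearing at step `r` would cap the transcendence degree at `k * k + r - 1` over
`S`, below the assumed `k * k + τ`. -/
theorem IsGenericPoint.linearIndependent_step (hd : d ≠ 0) (hS : algMatroid.eRk S ≠ ⊤)
    {v : Fin k → ℂ} (hv : IsGenericPoint S A τ v) (β : ℕ → Fin k → ℂ)
    (hβ : ∀ i, β i ^ d = (powMap d A)^[i] v ^ d) {r : ℕ} (hr : r ≤ τ)
    (hpow : LinearIndependent ℂ fun i : Fin r => (powMap d A)^[i] v ^ d)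
    (hli : LinearIndependent ℂ fun i : Fin r => β i) :
    LinearIndependent ℂ fun i : Fin (r + 1) => β i := by
  obtain ⟨⟨i₀, hi₀⟩, hτ⟩ := hv
  have hsnoc : (fun i : Fin (r + 1) => β i) =
      Fin.snoc (α := fun _ => Fin k → ℂ) (fun i : Fin r => β i) (β r) := by
    funext i
    refine Fin.lastCases ?_ (fun j => ?_) i <;> simp
  rw [hsnoc, linearIndependent_finSnoc]
  refine ⟨hli, fun hmem => ?_⟩
  rcases Nat.eq_zero_or_pos r with rfl | hr0
  · have h0 : β 0 = 0 := by simpa using hmem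
    have h1 := congrFun (hβ 0) i₀
    rw [h0] at h1
    simp [hd, hi₀] at h1
  · have h := eRk_add_one_le_of_dependent S A hd (fun i => (powMap d A)^[i] v) β
      (fun i => Function.iterate_succ_apply' _ _ _) hβ i₀ hi₀ r hr0 hpow hmem
    have h2 := (add_le_add_left hτ 1).trans h
    generalize algMatroid.eRk S = x at h2 hS
    lift x to ℕ using hS
    norm_cast at h2
    omega

theorem IsGenericPoint.linearIndependent_orbit (hA : A.det ≠ 0) (hd : d ≠ 0)
    (hS : algMatroid.eRk S ≠ ⊤) {r : ℕ} (hr : r ≤ τ + 1) :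
    ∀ v, IsGenericPoint S A τ v → LinearIndependent ℂ fun i : Fin r => (powMap d A)^[i] v := by
  induction r with
  | zero => exact fun v _ => linearIndependent_empty_type
  | succ r ih =>
    intro v hv
    have ih := ih (by omega)
    exact hv.linearIndependent_step hd hS (fun i => (powMap d A)^[i] v) (fun _ => rfl) (by omega)
      (hv.linearIndependent_pow hA hd ih) (ih v hv)

/-- The twist is needed because pulling an orbit back through `powMap d A` recovers each coordinate
only up to a `d`-th root of unity. The untwisted case supplies the independence of the powers. -/
theorem IsGenericPoint.linearIndependent_twisted_orbit (hA : A.det ≠ 0) (hd : d ≠ 0)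
    (hS : algMatroid.eRk S ≠ ⊤) {v : Fin k → ℂ} (hv : IsGenericPoint S A τ v)
    (β : ℕ → Fin k → ℂ) (hβ : ∀ i, β i ^ d = (powMap d A)^[i] v ^ d) {r : ℕ} (hr : r ≤ τ + 1) :
    LinearIndependent ℂ fun i : Fin r => β i := by
  induction r with
  | zero => exact linearIndependent_empty_type
  | succ r ih =>
    exact hv.linearIndependent_step hd hS β hβ (by omega)
      (hv.linearIndependent_pow hA hd (linearIndependent_orbit hA hd hS (by omega))) (ih (by omega))

end Dynamics

/-! ### Arithmetic of a generic triple `(t, A, a)`. -/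

section Generic

variable {k d : ℕ}

/-- The entries of `t`, `A` and `a` are algebraically independent over `ℚ`. -/
def IsGenericTriple (t A : Matrix (Fin k) (Fin k) ℂ) (a : Fin k → ℂ) : Prop :=
  AlgebraicIndependent ℚ (Sum.elim (Sum.elim (fun ij : Fin k × Fin k => t ij.1 ij.2)
    fun ij : Fin k × Fin k => A ij.1 ij.2) a)

theorem exists_isGenericTriple (k : ℕ) :
    ∃ (t A : Matrix (Fin k) (Fin k) ℂ) (a : Fin k → ℂ), IsGenericTriple t A a := by
  obtain ⟨p, hp⟩ :=
    exists_algebraicIndependent_complex (((Fin k × Fin k) ⊕ (Fin k × Fin k)) ⊕ Fin k)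
  refine ⟨fun i j => p (Sum.inl (Sum.inl (i, j))), fun i j => p (Sum.inl (Sum.inr (i, j))),
    fun i => p (Sum.inr i), ?_⟩
  have h1 : Sum.elim (Sum.elim (fun ij : Fin k × Fin k => p (Sum.inl (Sum.inl (ij.1, ij.2))))
      fun ij : Fin k × Fin k => p (Sum.inl (Sum.inr (ij.1, ij.2)))) (fun i => p (Sum.inr i)) = p := by
    funext i
    rcases i with (i | i) | i <;> rfl
  exact h1.symm ▸ hp

variable {t A : Matrix (Fin k) (Fin k) ℂ} {a : Fin k → ℂ}

theorem IsGenericTriple.det_ne_zero (h : IsGenericTriple t A a) : A.det ≠ 0 := by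
  have h1 := (h.comp Sum.inl Sum.inl_injective).comp Sum.inr Sum.inr_injective
  intro hdet
  refine Matrix.det_mvPolynomialX_ne_zero (Fin k) ℚ ((injective_iff_map_eq_zero _).mp h1 _ ?_)
  rw [AlgHom.map_det, ← hdet]
  congr 1
  ext i j
  simp

/-- The `r` independent conditions leave only `k - r` coordinates of `a` to adjoin to `Q` before the
whole triple is algebraic. -/
theorem IsGenericTriple.add_le_eRk (h : IsGenericTriple t A a) {Q : Set ℂ}
    (ht : entries t ⊆ algClosureOf Q) (hA : entries A ⊆ algClosureOf Q) {r : ℕ}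
    {u : Fin r → Fin k → ℂ} (hu : LinearIndependent ℂ u) (huQ : ∀ i j, u i j ∈ algClosureOf Q)
    (hau : ∀ i, a ⬝ᵥ u i ∈ algClosureOf Q) :
    ((k * k + k * k + r : ℕ) : ℕ∞) ≤ algMatroid.eRk Q := by
  obtain ⟨J, hJ, H⟩ := exists_coordinates_determine (algClosureOf Q) u huQ hu
  let U := Q ∪ Set.range fun j : J => a j
  have hQU : algClosureOf Q ≤ algClosureOf U := algClosureOf_mono Set.subset_union_left
  have ha := H _ hQU a (fun i => hQU (hau i)) fun j hj => subset_algClosureOf U (Or.inr ⟨⟨j, hj⟩, rfl⟩)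
  have h1 := card_le_eRk_of_algebraicIndependent (S := U) h (by
    rintro _ ⟨((i | i) | i), rfl⟩
    · exact hQU (ht ⟨i, rfl⟩)
    · exact hQU (hA ⟨i, rfl⟩)
    · exact ha i)
  have h2 := h1.trans (eRk_union_range_le _)
  simp only [Fintype.card_sum, Fintype.card_prod, Fintype.card_fin, Fintype.card_coe] at h2
  generalize algMatroid.eRk Q = x at h2
  induction x using ENat.recTopCoe with
  | top => exact le_top
  | coe x =>
    norm_cast at h2 ⊢
    omega

theorem IsGenericTriple.eRk_entries (h : IsGenericTriple t A a) :
    algMatroid.eRk (entries t) = (k * k : ℕ) := by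
  refine le_antisymm (eRk_entries_le t) ?_
  have := card_le_eRk_of_algebraicIndependent (S := entries t)
    ((h.comp Sum.inl Sum.inl_injective).comp Sum.inl Sum.inl_injective)
    (subset_algClosureOf (entries t))
  simpa using this

theorem eRk_entries_union_le (t A : Matrix (Fin k) (Fin k) ℂ) :
    algMatroid.eRk (entries t ∪ entries A) ≤ (k * k + k * k : ℕ) := by
  refine (Matroid.eRk_union_le_eRk_add_eRk _ _ _).trans ?_
  push_cast
  have h1 := eRk_entries_le t
  have h2 := eRk_entries_le A
  push_cast at h1 h2
  exact add_le_add h1 h2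

/-- Over the field generated by `t` and `A`, the form `a` has no algebraic value. -/
theorem IsGenericTriple.dotProduct_notMem (h : IsGenericTriple t A a) {u : Fin k → ℂ}
    (hu : u ≠ 0) (huQ : ∀ j, u j ∈ algClosureOf (entries t ∪ entries A)) :
    a ⬝ᵥ u ∉ algClosureOf (entries t ∪ entries A) := by
  intro hau
  have hsub := subset_algClosureOf (entries t ∪ entries A)
  have h1 := h.add_le_eRk (Q := entries t ∪ entries A) (Set.subset_union_left.trans hsub)
    (Set.subset_union_right.trans hsub) (r := 1) (u := fun _ => u)
    ((linearIndependent_unique_iff (v := fun _ : Fin 1 => u)).mpr hu) (fun _ => huQ) (fun _ => hau)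
  have h2 := h1.trans (eRk_entries_union_le t A)
  norm_cast at h2
  omega

/-- Row `i`, where `b' i ≠ 0`, determines `c`. Another row `j` then makes `A j m`, with `b m ≠ 0`,
algebraic over the other entries. A second row exists because `2 ≤ k`. -/
theorem IsGenericTriple.pow_powMap_ne_smul (h : IsGenericTriple t A a) (hk : 2 ≤ k) (hd : d ≠ 0)
    {b b' : Fin k → ℂ} (hb : b ≠ 0) (hb' : b' ≠ 0) (hbt : ∀ i, b i ∈ algClosureOf (entries t))
    (hbt' : ∀ i, b' i ∈ algClosureOf (entries t)) (c : ℂ) : powMap d A b ^ d ≠ c • b' ^ d := by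
  intro heq
  obtain ⟨m, hm⟩ := Function.ne_iff.mp hb
  obtain ⟨i, hi⟩ := Function.ne_iff.mp hb'
  have : Nontrivial (Fin k) := Fin.nontrivial_iff_two_le.mpr hk
  obtain ⟨j, hj⟩ := exists_ne i
  refine notMem_algClosureOf h (Sum.inl (Sum.inr (j, m))) ?_
  set D := algClosureOf ((Sum.elim (Sum.elim (fun ij : Fin k × Fin k => t ij.1 ij.2)
    fun ij : Fin k × Fin k => A ij.1 ij.2) a) '' {Sum.inl (Sum.inr (j, m))}ᶜ) with hD
  have htD : ∀ x ∈ algClosureOf (entries t), x ∈ D := by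
    refine algClosureOf_le ?_
    rintro _ ⟨ij, rfl⟩
    exact subset_algClosureOf _ ⟨Sum.inl (Sum.inl ij), by simp, rfl⟩
  have hAD : ∀ x y, (x, y) ≠ (j, m) → A x y ∈ D := fun x y hxy =>
    subset_algClosureOf _ ⟨Sum.inl (Sum.inr (x, y)), by simpa using hxy, rfl⟩
  have hcoord : ∀ x, powMap d A b x ^ d = c * b' x ^ d := fun x => congrFun heq x
  have hbd : ∀ x, b x ^ d ∈ D := fun x => pow_mem (htD _ (hbt x)) d
  have hi1 : powMap d A b i ∈ D := by
    rw [powMap, Matrix.mulVec, dotProduct]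
    exact sum_mem fun l _ => mul_mem (hAD i l (by simp [hj.symm])) (hbd l)
  have hc : c ∈ D := by
    have h1 : c = powMap d A b i ^ d * (b' i ^ d)⁻¹ := by
      rw [hcoord i, mul_inv_cancel_right₀ (pow_ne_zero _ hi)]
    rw [h1]
    exact mul_mem (pow_mem hi1 d) (inv_mem (pow_mem (htD _ (hbt' i)) d))
  have hj1 : powMap d A b j ∈ D := by
    refine mem_algClosureOf_of_pow hd ?_
    rw [hcoord j]
    exact mul_mem hc (pow_mem (htD _ (hbt' j)) d)
  rw [powMap, Matrix.mulVec, dotProduct, ← Finset.add_sum_erase _ _ (Finset.mem_univ m)] at hj1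
  have hsum : ∑ l ∈ Finset.univ.erase m, A j l * (b ^ d) l ∈ D :=
    sum_mem fun l hl => mul_mem (hAD j l (by simpa using Finset.ne_of_mem_erase hl)) (hbd l)
  have h2 := (add_mem_cancel_right hsum).mp hj1
  have h3 := mul_mem h2 (inv_mem (hbd m))
  rwa [Pi.pow_apply, mul_inv_cancel_right₀ (pow_ne_zero _ hm)] at h3

/-- Proportionality would be a polynomial identity in the entries of `A` over the algebraic closure
of `ℚ(t)`, hence would hold for every matrix over that field; one of rank one violates it. -/
theorem IsGenericTriple.powMap_iterate_ne_smul (h : IsGenericTriple t A a) (hk : 2 ≤ k)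
    {b y : Fin k → ℂ} (hb : b ≠ 0) (hbt : ∀ i, b i ∈ algClosureOf (entries t))
    (hyt : ∀ i, y i ∈ algClosureOf (entries t)) (hby : ∀ i, b i ≠ 0 → y i ≠ 0) (c : ℂ) (n : ℕ) :
    (powMap d A)^[n + 1] b ≠ c • y := by
  intro heq
  obtain ⟨m, hm⟩ := Function.ne_iff.mp hb
  have hym := hby m hm
  have : Nontrivial (Fin k) := Fin.nontrivial_iff_two_le.mpr hk
  obtain ⟨j, hj⟩ := exists_ne m
  let K := algClosureOf (entries t)
  let b' : Fin k → K := fun i => ⟨b i, hbt i⟩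
  let y' : Fin k → K := fun i => ⟨y i, hyt i⟩
  let Z : Fin k → MvPolynomial (Fin k × Fin k) K :=
    (powMap d (Matrix.mvPolynomialX (Fin k) (Fin k) K))^[n + 1] (MvPolynomial.C ∘ b')
  let P := Z j * MvPolynomial.C (y' m) - Z m * MvPolynomial.C (y' j)
  have hP : P = 0 := by
    refine eq_zero_of_aeval_eq_zero (h.comp Sum.inl Sum.inl_injective) P ?_
    let φ : MvPolynomial (Fin k × Fin k) K →+* ℂ :=
      (MvPolynomial.aeval fun ij : Fin k × Fin k => A ij.1 ij.2 : _ →ₐ[K] ℂ)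
    have hZ : φ ∘ Z = c • y := by
      have h1 : (Matrix.mvPolynomialX (Fin k) (Fin k) K).map φ = A := by
        ext i l
        simp [φ, Matrix.mvPolynomialX]
      have h2 : φ ∘ MvPolynomial.C ∘ b' = b := by
        funext i
        simp only [Function.comp_apply, φ, RingHom.coe_coe, MvPolynomial.aeval_C]
        rfl
      rw [map_powMap_iterate, ← heq, h1, h2]
    have hC : ∀ x : K, φ (MvPolynomial.C x) = x := fun x => by
      simp only [φ, RingHom.coe_coe, MvPolynomial.aeval_C]
      rfl
    change φ P = 0
    rw [map_sub, map_mul, map_mul, hC, hC]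
    have h1 : φ (Z j) = c * y j := congrFun hZ j
    have h2 : φ (Z m) = c * y m := congrFun hZ m
    rw [h1, h2]
    change c * y j * y m - c * y m * y j = 0
    ring
  have hym' : y' m ≠ 0 := fun h0 => hym (congrArg Subtype.val h0)
  have hbm' : b' m ≠ 0 := fun h0 => hm (congrArg Subtype.val h0)
  -- `A₀` has `w` as its only nonzero column, so all its iterates of `b'` are nonzero multiples of
  -- `w`. The summand 1 makes `w j * y' m - w m * y' j` equal to `y' m ≠ 0`.
  let w : Fin k → K := fun i => if i = m then 1 else y' j / y' m + 1
  let A₀ : Matrix (Fin k) (Fin k) K := fun i l => if l = m then w i else 0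
  have hA₀ : ∀ v, powMap d A₀ v = v m ^ d • w := fun v => by
    funext i
    simp [powMap, Matrix.mulVec, dotProduct, A₀, mul_comm]
  have hiter : ∀ n, ∃ e : K, e ≠ 0 ∧ (powMap d A₀)^[n + 1] b' = e • w := by
    intro n
    induction n with
    | zero => exact ⟨b' m ^ d, pow_ne_zero _ hbm', hA₀ _⟩
    | succ n ih =>
      obtain ⟨e, he, hn⟩ := ih
      refine ⟨e ^ d, pow_ne_zero _ he, ?_⟩
      rw [Function.iterate_succ_apply', hn, hA₀]
      simp [w]
  let ψ : MvPolynomial (Fin k × Fin k) K →+* K :=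
    MvPolynomial.eval fun ij : Fin k × Fin k => A₀ ij.1 ij.2
  obtain ⟨e, he, hn⟩ := hiter n
  have hZ : ψ ∘ Z = e • w := by
    have h1 : (Matrix.mvPolynomialX (Fin k) (Fin k) K).map ψ = A₀ := by
      ext i l
      simp [ψ, Matrix.mvPolynomialX]
    have h2 : ψ ∘ MvPolynomial.C ∘ b' = b' := by
      funext i
      simp [ψ]
    rw [map_powMap_iterate, ← hn, h1, h2]
  have h0 : ψ P = 0 := by rw [hP, map_zero]
  have h1 : ψ (Z j) = e * w j := congrFun hZ j
  have h2 : ψ (Z m) = e * w m := congrFun hZ m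
  rw [map_sub, map_mul, map_mul, h1, h2] at h0
  simp only [ψ, MvPolynomial.eval_C, w, hj, if_true, if_false] at h0
  have h3 : e * y' m = 0 := by
    rw [← h0]
    field_simp
    ring
  exact mul_ne_zero he hym' h3

theorem mem_algClosureOf_of_periodic (hd : 2 ≤ d) (hA : A.det ≠ 0) {v : Fin k → ℂ} {n : ℕ}
    (hn : 1 ≤ n) (hv : (powMap d A)^[n] v = v) (i : Fin k) : v i ∈ algClosureOf (entries A) := by
  -- All coordinates along the whole cycle are treated at once: inverting `A` writes each `d`-th
  -- power as a linear form in the coordinates of the next point.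
  let x : Fin n × Fin k → ℂ := fun p => (powMap d A)^[p.1] v p.2
  have hmem := fun i j => subset_algClosureOf _ (mem_entries A i j)
  have hinv : ∀ i j, A⁻¹ i j ∈ algClosureOf (entries A) := by
    intro i j
    refine mem_of_mulVec_mem _ hmem hA (h := fun i => A⁻¹ i j) (fun l => ?_) i
    have h1 : A.mulVec (fun i => A⁻¹ i j) l = (A * A⁻¹) l j := rfl
    rw [h1, Matrix.mul_nonsing_inv _ (isUnit_iff_ne_zero.mpr hA), Matrix.one_apply]
    split_ifs
    · exact one_mem _
    · exact zero_mem _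
  have hspan : ∀ m ≤ n, ∀ j, (powMap d A)^[m] v j ∈
      Submodule.span (algClosureOf (entries A)) (Set.range x) := by
    intro m hm j
    rcases hm.lt_or_eq with hm | rfl
    · exact Submodule.subset_span ⟨(⟨m, hm⟩, j), rfl⟩
    · rw [hv]
      exact Submodule.subset_span ⟨(⟨0, hn⟩, j), rfl⟩
  refine mem_algClosureOf_of_pow_mem_span hd x (fun p => ?_) (⟨0, hn⟩, i)
  have h1 : x p ^ d = A⁻¹.mulVec ((powMap d A)^[p.1 + 1] v) p.2 := by
    rw [Function.iterate_succ_apply', powMap, Matrix.mulVec_mulVec,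
      Matrix.nonsing_inv_mul _ (isUnit_iff_ne_zero.mpr hA), Matrix.one_mulVec]
    rfl
  rw [h1, Matrix.mulVec, dotProduct]
  refine Submodule.sum_mem _ fun j _ => ?_
  exact Submodule.smul_mem _ (⟨_, hinv p.2 j⟩ : algClosureOf (entries A)) (hspan _ p.1.2 j)

/-- If the second image were algebraic over `t` and `A`, so would be `c`, and then a nontrivial
linear form in `a`. -/
theorem IsGenericTriple.notMem_of_powMap_powMap (h : IsGenericTriple t A a) (hd : d ≠ 0)
    {c : Fin k → ℂ} (hc : c ≠ 0) (hac : a ⬝ᵥ c ^ d ∈ algClosureOf (entries t ∪ Set.range c)) :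
    ¬ ∀ i, powMap d A (powMap d A c) i ∈ algClosureOf (entries t ∪ entries A) := by
  intro hv
  have hA : ∀ i j, A i j ∈ algClosureOf (entries t ∪ entries A) :=
    fun i j => subset_algClosureOf _ (Or.inr (mem_entries A i j))
  have hcm := mem_of_powMap_mem hA h.det_ne_zero hd (mem_of_powMap_mem hA h.det_ne_zero hd hv)
  refine h.dotProduct_notMem (u := c ^ d) (fun h0 => hc (by simpa [hd] using h0))
    (fun i => pow_mem (hcm i) d) (algClosureOf_le ?_ hac)
  rintro x (hx | ⟨i, rfl⟩)
  · exact subset_algClosureOf _ (Or.inl hx)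
  · exact hcm i

theorem IsGenericTriple.not_forall_exists_powMap_powMap (h : IsGenericTriple t A a) (hd : d ≠ 0)
    {v : Fin k → ℂ} {i₀ : Fin k} (hi₀ : v i₀ = 1) :
    ¬ ∀ i ≤ k, ∃ c : Fin k → ℂ, powMap d A (powMap d A c) = (powMap d A)^[i + 1] v ∧
      a ⬝ᵥ c ^ d ∈ algClosureOf (entries t ∪ Set.range c) := by
  intro H
  set Q := entries t ∪ entries A ∪ Set.range v with hQ
  have hsub := subset_algClosureOf Q
  have hfin : algMatroid.eRk Q ≤ (k * k + k * k + k : ℕ) := by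
    refine (eRk_union_range_le _).trans ?_
    rw [Nat.cast_add]
    exact add_le_add (eRk_entries_union_le t A) (by simp)
  have hlow : ((k * k + k * k + 0 : ℕ) : ℕ∞) ≤ algMatroid.eRk Q :=
    h.add_le_eRk (u := Fin.elim0) (fun x hx => hsub (Or.inl (Or.inl hx)))
      (fun x hx => hsub (Or.inl (Or.inr hx))) linearIndependent_empty_type
      (fun i => i.elim0) (fun i => i.elim0)
  -- `τ` is the transcendence degree of `v` over `(t, A)`.
  obtain ⟨τ, hτk, hτ⟩ : ∃ τ ≤ k, algMatroid.eRk Q = (k * k + k * k + τ : ℕ) := by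
    generalize algMatroid.eRk Q = x at hfin hlow
    lift x to ℕ using ne_top_of_le_ne_top (ENat.natCast_ne_top _) hfin
    norm_cast at hfin hlow
    exact ⟨x - (k * k + k * k), by omega, by norm_cast; omega⟩
  have hgen : IsGenericPoint (entries t) A τ v := by
    refine ⟨⟨i₀, hi₀⟩, ?_⟩
    rw [h.eRk_entries, ← hQ, hτ]
    norm_cast
    omega
  have hA : ∀ i j, A i j ∈ algClosureOf Q := fun i j => hsub (Or.inl (Or.inr (mem_entries A i j)))
  have horb : ∀ n j, (powMap d A)^[n] v j ∈ algClosureOf Q := by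
    intro n
    induction n with
    | zero => exact fun j => hsub (Or.inr ⟨j, rfl⟩)
    | succ n ih => rw [Function.iterate_succ_apply']; exact powMap_mem hA ih
  choose! c hc1 hc2 using H
  have hcQ : ∀ i ≤ k, ∀ j, c i j ∈ algClosureOf Q := fun i hi => by
    refine mem_of_powMap_mem hA h.det_ne_zero hd (mem_of_powMap_mem hA h.det_ne_zero hd ?_)
    rw [hc1 i hi]
    exact horb _
  -- Cancelling one application of `powMap d A` in `hc1` shows that the images of the `c i` form a
  -- twisted orbit of `v`. The second branch only makes `β` total.
  let β : ℕ → Fin k → ℂ := fun i => if i ≤ k then powMap d A (c i) else (powMap d A)^[i] v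
  have hβ : ∀ i, β i ^ d = (powMap d A)^[i] v ^ d := by
    intro i
    by_cases hi : i ≤ k
    · rw [← powMap_eq_powMap_iff h.det_ne_zero, ← Function.iterate_succ_apply' (powMap d A),
        ← hc1 i hi]
      simp only [β, if_pos hi]
    · simp only [β, if_neg hi]
  have hli := hgen.linearIndependent_twisted_orbit h.det_ne_zero hd
    (by rw [h.eRk_entries]; exact ENat.natCast_ne_top _) β hβ le_rfl
  have hle : ∀ i : Fin (τ + 1), (i : ℕ) ≤ k := fun i => by omega
  have hli2 : LinearIndependent ℂ fun i : Fin (τ + 1) => c i ^ d := by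
    refine linearIndependent_of_mulVec A _ ?_
    convert hli using 2 with i
    simp only [β, if_pos (hle i)]
    rfl
  have hfinal := h.add_le_eRk (Q := Q) (fun x hx => hsub (Or.inl (Or.inl hx)))
      (fun x hx => hsub (Or.inl (Or.inr hx))) hli2 (fun i j => pow_mem (hcQ i (hle i) j) d)
      fun i => algClosureOf_le (by
        rintro x (hx | ⟨j, rfl⟩)
        · exact hsub (Or.inl (Or.inl hx))
        · exact hcQ i (hle i) j) (hc2 i (hle i))
  rw [hτ] at hfinal
  norm_cast at hfinal
  omega

end Generic

/-! ### Roots of unity in a hyperplane, and large fibres of `f_∞⁺`. -/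

section Grid

variable {k d : ℕ}

/-- More than `d ^ (#J - 1)` points of the grid `μ_dᴶ` are not contained in an affine hyperplane. -/
theorem mem_of_forall_sum_mem_of_card_lt (hd : d ≠ 0) (C : Subfield ℂ)
    (hC : ∀ ζ : ℂ, ζ ^ d = 1 → ζ ∈ C) (J : Finset (Fin k)) (s : Finset (Fin k → ℂ))
    (hs : ∀ ζ ∈ s, ∀ j, ζ j ^ d = 1) (hsJ : ∀ ζ ∈ s, ∀ j ∉ J, ζ j = 1)
    (hcard : d ^ (J.card - 1) < s.card) (x : Fin k → ℂ)
    (hx : ∀ ζ ∈ s, ∑ j ∈ J, x j * (ζ j - 1) ∈ C) : ∀ j ∈ J, x j ∈ C := by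
  classical
  let δ : s → J → C := fun ζ j =>
    ⟨ζ.1 j - 1, sub_mem (hC _ (hs _ ζ.2 j)) (one_mem _)⟩
  let L : Submodule C (J → C) :=
    { carrier := {y | ∑ j : J, x j * (y j : ℂ) ∈ C}
      add_mem' := fun {y z} hy hz => by
        have h1 : ∑ j : J, x j * (y j : ℂ) ∈ C := hy
        have h2 : ∑ j : J, x j * (z j : ℂ) ∈ C := hz
        have h3 := add_mem h1 h2
        rw [← Finset.sum_add_distrib] at h3
        change ∑ j : J, x j * ((y j + z j : C) : ℂ) ∈ C
        simpa only [Subfield.coe_add, mul_add] using h3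
      zero_mem' := by
        change ∑ j : J, x j * ((0 : C) : ℂ) ∈ C
        simp
      smul_mem' := fun α y hy => by
        have h1 : ∑ j : J, x j * (y j : ℂ) ∈ C := hy
        have h2 := mul_mem α.2 h1
        rw [Finset.mul_sum] at h2
        change ∑ j : J, x j * ((α * y j : C) : ℂ) ∈ C
        simpa only [Subfield.coe_mul, mul_left_comm] using h2 }
  have hδL : ∀ ζ, δ ζ ∈ L := fun ζ => by
    change ∑ j : J, x j * (ζ.1 j - 1) ∈ C
    rw [Finset.sum_coe_sort J fun j => x j * (ζ.1 j - 1)]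
    exact hx _ ζ.2
  have hL : L = ⊤ := by
    by_contra hL
    obtain ⟨φ, hφ, hker⟩ := Submodule.exists_le_ker_of_lt_top L (lt_top_iff_ne_top.mpr hL)
    obtain ⟨l, hl⟩ : ∃ l, φ (Pi.single l 1) ≠ 0 := by
      by_contra! h0
      refine hφ (LinearMap.pi_ext' fun l => LinearMap.ext_ring ?_)
      simpa using h0 l
    -- On the hyperplane `φ = 0` the coordinate `l` is a function of the others, so it meets the
    -- grid in at most `d ^ (J.card - 1)` points.
    have hsep : ∀ ζ ζ' : s, (∀ j : J, j ≠ l → ζ.1 j = ζ'.1 j) → ζ = ζ' := by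
      intro ζ ζ' h
      have h1 : δ ζ - δ ζ' = (δ ζ l - δ ζ' l) • Pi.single l 1 := by
        funext j
        by_cases hj : j = l
        · subst hj; simp
        · have h2 : δ ζ j = δ ζ' j := Subtype.ext (congrArg (· - 1) (h j hj))
          simp [hj, h2]
      have h2 : φ (δ ζ - δ ζ') = 0 := by
        rw [map_sub, hker (hδL ζ), hker (hδL ζ'), sub_zero]
      rw [h1, map_smul, smul_eq_mul, mul_eq_zero, or_iff_left hl, sub_eq_zero] at h2
      have h3 : ζ.1 l = ζ'.1 l := sub_left_injective (congrArg Subtype.val h2)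
      refine Subtype.ext (funext fun j => ?_)
      by_cases hj : j ∈ J
      · by_cases hjl : (⟨j, hj⟩ : J) = l
        · rw [← hjl] at h3; exact h3
        · exact h ⟨j, hj⟩ hjl
      · rw [hsJ _ ζ.2 j hj, hsJ _ ζ'.2 j hj]
    have hle : Fintype.card s ≤ (Fintype.piFinset fun _ : {j : J // j ≠ l} =>
        Polynomial.nthRootsFinset d (1 : ℂ)).card := by
      rw [← Finset.card_univ]
      refine Finset.card_le_card_of_injOn (fun ζ j => ζ.1 j.1) (fun ζ _ => ?_) fun ζ _ ζ' _ h => ?_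
      · rw [Finset.mem_coe, Fintype.mem_piFinset]
        intro j
        exact (Polynomial.mem_nthRootsFinset (Nat.pos_of_ne_zero hd) _).mpr (hs _ ζ.2 _)
      · exact hsep ζ ζ' fun j hj => congrFun h ⟨j, hj⟩
    rw [Fintype.card_piFinset, Finset.prod_const, Finset.card_univ, Fintype.card_coe, Fintype.card_subtype_compl,
      Fintype.card_coe, Fintype.card_subtype_eq] at hle
    have hroots : (Polynomial.nthRootsFinset d (1 : ℂ)).card ≤ d := by
      rw [Polynomial.nthRootsFinset_def]
      exact (Multiset.toFinset_card_le _).trans (Polynomial.card_nthRoots d 1)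
    exact absurd (hle.trans (Nat.pow_le_pow_left hroots _)) (not_le.mpr hcard)
  intro j hj
  have h1 : Pi.single ⟨j, hj⟩ 1 ∈ L := hL ▸ Submodule.mem_top
  have h2 : ∑ i : J, x i * ((Pi.single ⟨j, hj⟩ 1 : J → C) i : ℂ) = x j := by
    rw [Finset.sum_eq_single ⟨j, hj⟩]
    · simp
    · intro i _ hi
      simp [Pi.single_eq_of_ne hi]
    · simp
  rw [← h2]
  exact h1

/-- The polynomial function `∑ tᵢⱼ vᵢᵈ⁻¹ vⱼ`. -/
def mixedForm (d : ℕ) (t : Matrix (Fin k) (Fin k) ℂ) (v : Fin k → ℂ) : ℂ :=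
  ∑ i, ∑ j, t i j * (v i ^ (d - 1) * v j)

theorem mem_algClosureOf_of_mixedForm_eq (hd : d ≠ 0) {t : Matrix (Fin k) (Fin k) ℂ}
    (ht : AlgebraicIndependent ℚ fun ij : Fin k × Fin k => t ij.1 ij.2)
    {b : Fin k → ℂ} {i₀ : Fin k} (hb : b i₀ = 1) (J : Finset (Fin k))
    (hJ : ∀ j, j ∈ J ↔ j ≠ i₀ ∧ b j ≠ 0) (s : Finset (Fin k → ℂ))
    (hs : ∀ ζ ∈ s, ∀ j, ζ j ^ d = 1) (hsJ : ∀ ζ ∈ s, ∀ j ∉ J, ζ j = 1)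
    (hsR : ∀ ζ ∈ s, mixedForm d t (ζ * b) = mixedForm d t b)
    (hcard : d ^ (J.card - 1) < s.card) (i : Fin k) : b i ∈ algClosureOf (entries t) := by
  classical
  -- In row `i₀` of `t`, the entries indexed by `J` are traded for the coordinates of `b`, keeping
  -- the number of parameters at `k * k`. Since `ζ` and `b` are 1 at `i₀`, the equations are linear
  -- in the products `t i₀ j * b j`, so they return the traded entries; by exchange, `b` is
  -- algebraic over `t`.
  let q : Fin k × Fin k → ℂ := fun ij => if ij.1 = i₀ ∧ ij.2 ∈ J then b ij.2 else t ij.1 ij.2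
  have hq : ∀ ij, q ij ∈ algClosureOf (Set.range q) := fun ij => subset_algClosureOf _ ⟨ij, rfl⟩
  have hbq : ∀ j, b j ∈ algClosureOf (Set.range q) := by
    intro j
    by_cases hj : j ∈ J
    · have := hq (i₀, j)
      rwa [show q (i₀, j) = b j from if_pos ⟨rfl, hj⟩] at this
    · by_cases hji : j = i₀
      · rw [hji, hb]; exact one_mem _
      · have h0 : b j = 0 := by
          by_contra h0
          exact hj ((hJ j).mpr ⟨hji, h0⟩)
        rw [h0]; exact zero_mem _
  have htq : ∀ i j, ¬(i = i₀ ∧ j ∈ J) → t i j ∈ algClosureOf (Set.range q) := by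
    intro i j hij
    have := hq (i, j)
    rwa [show q (i, j) = t i j from if_neg hij] at this
  have hζq : ∀ ζ : ℂ, ζ ^ d = 1 → ζ ∈ algClosureOf (Set.range q) :=
    fun ζ hζ => mem_algClosureOf_of_pow_eq_one hd hζ
  have hi₀ : i₀ ∉ J := fun h => ((hJ i₀).mp h).1 rfl
  have hx := mem_of_forall_sum_mem_of_card_lt hd (algClosureOf (Set.range q)) hζq J s hs hsJ hcard
    (fun j => t i₀ j * b j) fun ζ hζ => by
      have hsub := sub_eq_zero.mpr (hsR ζ hζ)
      rw [mixedForm, mixedForm, ← Finset.sum_sub_distrib] at hsub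
      simp only [← Finset.sum_sub_distrib, ← mul_sub] at hsub
      rw [← Finset.add_sum_erase _ _ (Finset.mem_univ i₀),
        ← Finset.sum_subset (Finset.subset_univ J) (fun j _ hj => ?_)] at hsub
      · have h1 : ∑ j ∈ J, t i₀ j * b j * (ζ j - 1) = ∑ j ∈ J, t i₀ j *
            ((ζ * b) i₀ ^ (d - 1) * (ζ * b) j - b i₀ ^ (d - 1) * b j) := by
          refine Finset.sum_congr rfl fun j _ => ?_
          simp only [Pi.mul_apply, hb, hsJ ζ hζ i₀ hi₀, one_pow, one_mul]
          ring
        rw [h1, eq_neg_of_add_eq_zero_left hsub]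
        refine neg_mem (sum_mem fun i hi => sum_mem fun j _ => ?_)
        have hne := Finset.ne_of_mem_erase hi
        have hζb : ∀ l, (ζ * b) l ∈ algClosureOf (Set.range q) :=
          fun l => mul_mem (hζq _ (hs ζ hζ l)) (hbq l)
        exact mul_mem (htq i j fun h => hne h.1)
          (sub_mem (mul_mem (pow_mem (hζb i) _) (hζb j)) (mul_mem (pow_mem (hbq i) _) (hbq j)))
      · simp only [Pi.mul_apply, hb, hsJ ζ hζ i₀ hi₀, hsJ ζ hζ j hj, one_pow, one_mul, sub_self,
          mul_zero]
  have hrange : Set.range (fun ij : Fin k × Fin k => t ij.1 ij.2) ⊆ algClosureOf (Set.range q) := by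
    rintro _ ⟨⟨i, j⟩, rfl⟩
    by_cases hij : i = i₀ ∧ j ∈ J
    · obtain ⟨rfl, hj⟩ := hij
      have h1 := mul_mem (hx j hj) (inv_mem (hbq j))
      rwa [mul_inv_cancel_right₀ ((hJ j).mp hj).2] at h1
    · exact htq i j hij
  refine algClosureOf_le_of_eRk_le ht hrange ?_ (hbq i)
  have h1 := eRk_union_range_le (S := ∅) q
  simpa using h1

end Grid

/-! ### Normalised representatives and charts of projective space. -/

section Projective

variable {k d : ℕ}

theorem CP.exists_eq_mk_normalized (z : CP k) :
    ∃ (v : Fin k → ℂ) (hv : v ≠ 0) (i : Fin k), v i = 1 ∧ z = Projectivization.mk ℂ v hv := by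
  obtain ⟨i, hi⟩ := Function.ne_iff.mp z.rep_nonzero
  have hi' : z.rep i ≠ 0 := hi
  refine ⟨(z.rep i)⁻¹ • z.rep, smul_ne_zero (inv_ne_zero hi') z.rep_nonzero, i,
    inv_mul_cancel₀ hi', ?_⟩
  conv_lhs => rw [← z.mk_rep]
  rw [Projectivization.mk_eq_mk_iff']
  exact ⟨z.rep i, by rw [smul_smul, mul_inv_cancel₀ hi', one_smul]⟩

theorem exists_nhds_injOn_pow (hd : d ≠ 0) (x : ℂ) :
    ∃ N : Set ℂ, IsOpen N ∧ x ∈ N ∧ (x ≠ 0 → Set.InjOn (fun y : ℂ => y ^ d) N) := by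
  by_cases hx : x = 0
  · exact ⟨Set.univ, isOpen_univ, trivial, fun h => absurd hx h⟩
  have h1 : HasStrictDerivAt (fun y : ℂ => y ^ d) (d * x ^ (d - 1)) x := hasStrictDerivAt_pow d x
  have h2 : (d * x ^ (d - 1) : ℂ) ≠ 0 :=
    mul_ne_zero (Nat.cast_ne_zero.mpr hd) (pow_ne_zero _ hx)
  obtain ⟨N, hN, hNo, hxN⟩ := eventually_nhds_iff.mp (h1.eventually_left_inverse h2)
  refine ⟨N, hNo, hxN, fun _ y hy z hz hyz => ?_⟩
  rw [← hN y hy, ← hN z hz]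
  exact congrArg _ hyz

theorem isOpen_setOf_normalized (i₀ : Fin k) (N : Fin k → Set ℂ) (hN : ∀ j, IsOpen (N j)) :
    IsOpen {z : CP k | ∃ (w : Fin k → ℂ) (hw : w ≠ 0), w i₀ = 1 ∧ (∀ j, w j ∈ N j) ∧
      z = Projectivization.mk ℂ w hw} := by
  let S := {z : CP k | ∃ (w : Fin k → ℂ) (hw : w ≠ 0), w i₀ = 1 ∧ (∀ j, w j ∈ N j) ∧
    z = Projectivization.mk ℂ w hw}
  change IsOpen ((fun w : {w : Fin k → ℂ // w ≠ 0} => (Projectivization.mk ℂ w.1 w.2 : CP k)) ⁻¹' S)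
  have hpre : (fun w : {w : Fin k → ℂ // w ≠ 0} => (Projectivization.mk ℂ w.1 w.2 : CP k)) ⁻¹' S =
      {w | w.1 i₀ ≠ 0} ∩ ⋂ j, {w | w.1 i₀ ≠ 0 ∧ w.1 j / w.1 i₀ ∈ N j} := by
    ext ⟨u, hu⟩
    simp only [Set.mem_preimage, Set.mem_inter_iff, Set.mem_iInter]
    constructor
    · rintro ⟨w, hw, hw1, hwN, heq⟩
      obtain ⟨c, hc⟩ := (Projectivization.mk_eq_mk_iff' _ _ _ _ _).mp heq
      have hc0 : c ≠ 0 := by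
        rintro rfl
        exact hu (by rw [← hc, zero_smul])
      have hui : u i₀ = c := by rw [← hc, Pi.smul_apply, hw1, smul_eq_mul, mul_one]
      have hne : u i₀ ≠ 0 := hui ▸ hc0
      refine ⟨hne, fun j => ⟨hne, ?_⟩⟩
      have : u j / u i₀ = w j := by
        rw [hui, ← hc, Pi.smul_apply, smul_eq_mul, mul_div_cancel_left₀ _ hc0]
      change u j / u i₀ ∈ N j
      rw [this]
      exact hwN j
    · rintro ⟨hne, hj⟩
      have hne' : u i₀ ≠ 0 := hne
      refine ⟨(u i₀)⁻¹ • u, smul_ne_zero (inv_ne_zero hne') hu, inv_mul_cancel₀ hne', fun j => ?_,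
        ?_⟩
      · have := (hj j).2
        rwa [div_eq_inv_mul] at this
      · rw [Projectivization.mk_eq_mk_iff']
        exact ⟨u i₀, by rw [smul_smul, mul_inv_cancel₀ hne', one_smul]⟩
  rw [hpre]
  have hcont : ∀ j, Continuous fun w : {w : Fin k → ℂ // w ≠ 0} => w.1 j :=
    fun j => (continuous_apply j).comp continuous_subtype_val
  have hopen : IsOpen {w : {w : Fin k → ℂ // w ≠ 0} | w.1 i₀ ≠ 0} :=
    isOpen_ne_fun (hcont i₀) continuous_const
  refine hopen.inter (isOpen_iInter_of_finite fun j => ?_)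
  exact (ContinuousOn.div (hcont j).continuousOn (hcont i₀).continuousOn
    fun w hw => hw).isOpen_inter_preimage hopen (hN j)

end Projective

/-! ### The generic map: describing `X` and `Y`, then their orbits. -/

namespace FamilyF

variable {k d : ℕ} (f : FamilyF k d) {t A : Matrix (Fin k) (Fin k) ℂ} {a : Fin k → ℂ}

/-- `f_∞` is induced by `v ↦ A vᵈ` and `R` is `∑ tᵢⱼ vᵢᵈ⁻¹ vⱼ + ∑ aᵢ vᵢᵈ`. -/
structure IsMixedPower (t A : Matrix (Fin k) (Fin k) ℂ) (a : Fin k → ℂ) : Prop where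
  FVec_eq : ∀ v, f.FVec v = powMap d A v
  RVal_eq : ∀ v, f.RVal v = mixedForm d t v + a ⬝ᵥ v ^ d

theorem exists_isMixedPower (hd : 2 ≤ d) (t A : Matrix (Fin k) (Fin k) ℂ) (a : Fin k → ℂ)
    (hA : A.det ≠ 0) : ∃ f : FamilyF k d, f.IsMixedPower t A a := by
  let F : Fin k → MvPolynomial (Fin k) ℂ := fun i =>
    ∑ j, MvPolynomial.C (A i j) * MvPolynomial.X j ^ d
  let R : MvPolynomial (Fin k) ℂ :=
    ∑ i, ∑ j, MvPolynomial.C (t i j) * (MvPolynomial.X i ^ (d - 1) * MvPolynomial.X j) +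
      ∑ i, MvPolynomial.C (a i) * MvPolynomial.X i ^ d
  have hd1 : d - 1 + 1 = d := by omega
  have hF : ∀ v i, MvPolynomial.eval v (F i) = powMap d A v i := fun v i => by
    simp [F, powMap, Matrix.mulVec, dotProduct]
  have hR : ∀ v, MvPolynomial.eval v R = mixedForm d t v + a ⬝ᵥ v ^ d := fun v => by
    simp [R, mixedForm, dotProduct]
  refine ⟨⟨F, R, hd, fun i => ?_, ?_, fun v hv => ?_⟩, fun v => funext fun i => hF v i, hR⟩
  · refine MvPolynomial.IsHomogeneous.sum _ _ _ fun j _ => ?_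
    exact (MvPolynomial.isHomogeneous_X_pow j d).C_mul _
  · refine MvPolynomial.IsHomogeneous.add ?_ ?_
    · refine MvPolynomial.IsHomogeneous.sum _ _ _ fun i _ =>
        MvPolynomial.IsHomogeneous.sum _ _ _ fun j _ => ?_
      have := (MvPolynomial.isHomogeneous_X_pow (R := ℂ) i (d - 1)).mul
        (MvPolynomial.isHomogeneous_X ℂ j)
      rw [hd1] at this
      exact this.C_mul _
    · refine MvPolynomial.IsHomogeneous.sum _ _ _ fun j _ => ?_
      exact (MvPolynomial.isHomogeneous_X_pow j d).C_mul _
  · by_contra hv0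
    refine powMap_ne_zero hA (d := d) (by omega) hv0 (funext fun i => ?_)
    rw [← hF]
    exact hv i

variable {f}

theorem ne_zero_of_family (f : FamilyF k d) : d ≠ 0 := by have := f.two_le; omega

theorem fInf_mk (f : FamilyF k d) (v : Fin k → ℂ) (hv : v ≠ 0) :
    f.fInf (Projectivization.mk ℂ v hv) =
      Projectivization.mk ℂ (f.FVec v) (f.FVec_ne_zero v hv) := rfl

theorem fPlus_mk (f : FamilyF k d) (v : Fin k → ℂ) (hv : v ≠ 0) :
    f.fPlus (Projectivization.mk ℂ v hv) =
      Projectivization.mk ℂ (f.plusVec v) (f.plusVec_ne_zero v hv) := rfl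

theorem fEps_mk (f : FamilyF k d) (ε : ℂ) (v : Fin (k + 1) → ℂ) (hv : v ≠ 0) :
    f.fEps ε (Projectivization.mk ℂ v hv) =
      Projectivization.mk ℂ (f.epsVec ε v) (f.epsVec_ne_zero ε v hv) := rfl

namespace IsMixedPower

theorem fInf_mk (hf : f.IsMixedPower t A a) (v : Fin k → ℂ) (hv : v ≠ 0) : ∃ h, f.fInf (Projectivization.mk ℂ v hv) =
    Projectivization.mk ℂ (powMap d A v) h := by
  have h := f.FVec_ne_zero v hv
  have h2 := f.fInf_mk v hv
  simp only [hf.FVec_eq] at h h2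
  exact ⟨h, h2⟩

theorem iterate_fInf_mk (hf : f.IsMixedPower t A a) (v : Fin k → ℂ) (hv : v ≠ 0) (n : ℕ) :
    ∃ h, f.fInf^[n] (Projectivization.mk ℂ v hv) =
      Projectivization.mk ℂ ((powMap d A)^[n] v) h := by
  induction n with
  | zero => exact ⟨hv, rfl⟩
  | succ n ih =>
    obtain ⟨h, hn⟩ := ih
    rw [Function.iterate_succ_apply' (powMap d A), Function.iterate_succ_apply' f.fInf, hn]
    exact hf.fInf_mk _ h

/-- In the chart `w i₀ = 1` the map is a coordinatewise power followed by an injective linear map: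
locally injective in nonzero coordinates, at most `d`-to-one in the vanishing ones. -/
theorem localMultiplicity_le (hf : f.IsMixedPower t A a) (hA : A.det ≠ 0) {v : Fin k → ℂ} (hv : v ≠ 0) {i₀ : Fin k}
    (hi₀ : v i₀ = 1) : localMultiplicity f.fInf (Projectivization.mk ℂ v hv) ≤
      (d ^ Fintype.card {j // j ≠ i₀ ∧ v j = 0} : ℕ) := by
  classical
  have hd := f.ne_zero_of_family
  choose N hNo hvN hNinj using fun j => exists_nhds_injOn_pow hd (v j)
  refine iInf₂_le_of_le _ ((isOpen_setOf_normalized i₀ N hNo).mem_nhds ⟨v, hv, hi₀, hvN, rfl⟩)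
    (iSup_le fun y => ?_)
  set S := {z : CP k | ∃ (w : Fin k → ℂ) (hw : w ≠ 0), w i₀ = 1 ∧ (∀ j, w j ∈ N j) ∧
      z = Projectivization.mk ℂ w hw} ∩ f.fInf ⁻¹' {y} with hS
  choose! w hw0 hw1 hwN hwz using fun (z : CP k) (hz : z ∈ S) => hz.1
  have hpow : ∀ z ∈ S, ∀ z' ∈ S, w z ^ d = w z' ^ d := by
    intro z hz z' hz'
    have h1 : f.fInf z = f.fInf z' := hz.2.trans hz'.2.symm
    rw [hwz z hz, hwz z' hz'] at h1
    obtain ⟨_, h2⟩ := hf.fInf_mk (w z) (hw0 z hz)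
    obtain ⟨_, h3⟩ := hf.fInf_mk (w z') (hw0 z' hz')
    rw [h2, h3, Projectivization.mk_eq_mk_iff'] at h1
    obtain ⟨c, hc⟩ := h1
    obtain ⟨μ, hμ⟩ := IsAlgClosed.exists_pow_nat_eq c (Nat.pos_of_ne_zero hd)
    rw [← hμ, ← powMap_smul, powMap_eq_powMap_iff hA] at hc
    have h4 := congrFun hc i₀
    simp only [Pi.pow_apply, Pi.smul_apply, smul_eq_mul, hw1 z hz, hw1 z' hz', mul_one,
      one_pow] at h4
    rw [← hc, smul_pow, h4, one_smul]
  rcases S.eq_empty_or_nonempty with h0 | ⟨z₀, hz₀⟩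
  · rw [h0, Set.encard_empty]
    exact zero_le
  let T : Finset ({j // j ≠ i₀ ∧ v j = 0} → ℂ) :=
    Fintype.piFinset fun j => (Polynomial.nthRoots d (w z₀ j ^ d)).toFinset
  have hmaps : Set.MapsTo (fun z (j : {j // j ≠ i₀ ∧ v j = 0}) => w z j) S T := by
    intro z hz
    rw [Finset.mem_coe, Fintype.mem_piFinset]
    intro j
    rw [Multiset.mem_toFinset, Polynomial.mem_nthRoots (Nat.pos_of_ne_zero hd)]
    exact congrFun (hpow z hz z₀ hz₀) j
  have hinj : Set.InjOn (fun z (j : {j // j ≠ i₀ ∧ v j = 0}) => w z j) S := by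
    intro z hz z' hz' h
    have hww : w z = w z' := by
      funext j
      by_cases hj : j = i₀
      · rw [hj, hw1 z hz, hw1 z' hz']
      by_cases hvj : v j = 0
      · exact congrFun h ⟨j, hj, hvj⟩
      · exact hNinj j hvj (hwN z hz j) (hwN z' hz' j) (congrFun (hpow z hz z' hz') j)
    rw [hwz z hz, hwz z' hz']
    simp only [hww]
  refine (Set.encard_le_encard_of_injOn hmaps hinj).trans ?_
  rw [Set.encard_coe_eq_coe_finsetCard, Nat.cast_le, Fintype.card_piFinset]
  refine (Finset.prod_le_pow_card _ _ d fun j _ => ?_).trans (by rw [Finset.card_univ])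
  exact (Multiset.toFinset_card_le _).trans (Polynomial.card_nthRoots d _)

/-- Points in one fibre of `f_∞` differ by roots of unity, which do not affect `a ⬝ᵥ v^d`; equality
of `R` therefore only constrains the mixed part. Setting `ζ` to 1 where `b` vanishes removes its
ambiguity. -/
theorem exists_root_of_fPlus_eq (hf : f.IsMixedPower t A a) (hA : A.det ≠ 0) {b : Fin k → ℂ} (hb : b ≠ 0) {i₀ : Fin k}
    (hi₀ : b i₀ = 1) {z : CP k} (hz : f.fPlus z = f.fPlus (Projectivization.mk ℂ b hb)) :
    ∃ ζ : Fin k → ℂ, (∀ j, ζ j ^ d = 1) ∧ (∀ j, j = i₀ ∨ b j = 0 → ζ j = 1) ∧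
      mixedForm d t (ζ * b) = mixedForm d t b ∧ ∃ h, z = Projectivization.mk ℂ (ζ * b) h := by
  classical
  have hd := f.ne_zero_of_family
  obtain ⟨u, hu, -, -, rfl⟩ := z.exists_eq_mk_normalized
  rw [FamilyF.fPlus_mk, FamilyF.fPlus_mk, Projectivization.mk_eq_mk_iff'] at hz
  obtain ⟨c, hc⟩ := hz
  have hF : c • f.FVec b = f.FVec u := by
    funext i
    simpa [plusVec] using congrFun hc i.castSucc
  have hR : c * f.RVal b = f.RVal u := by
    simpa [plusVec] using congrFun hc (Fin.last k)
  rw [hf.FVec_eq, hf.FVec_eq] at hF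
  obtain ⟨μ, hμ⟩ := IsAlgClosed.exists_pow_nat_eq c (Nat.pos_of_ne_zero hd)
  rw [← hμ, ← powMap_smul, powMap_eq_powMap_iff hA] at hF
  have hpow : ∀ j, μ ^ d * b j ^ d = u j ^ d := fun j => by
    have := congrFun hF j
    simpa [mul_pow] using this
  have hui : μ ^ d = u i₀ ^ d := by rw [← hpow, hi₀, one_pow, mul_one]
  have hμ0 : μ ≠ 0 := by
    rintro rfl
    refine hu (funext fun j => ?_)
    have := hpow j
    rw [zero_pow hd, zero_mul] at this
    exact (pow_eq_zero_iff hd).mp this.symm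
  have hu0 : u i₀ ≠ 0 := fun h => by
    rw [h, zero_pow hd] at hui
    exact hμ0 ((pow_eq_zero_iff hd).mp hui)
  let ζ : Fin k → ℂ := fun j => if b j = 0 then 1 else u j / u i₀ / b j
  have hζu : ζ * b = (u i₀)⁻¹ • u := by
    funext j
    simp only [Pi.mul_apply, Pi.smul_apply, smul_eq_mul, ζ]
    split_ifs with h0
    · have h1 := hpow j
      rw [h0, zero_pow hd, mul_zero] at h1
      rw [(pow_eq_zero_iff hd).mp h1.symm, h0, mul_zero, mul_zero]
    · field_simp
  have hne : ζ * b ≠ 0 := hζu ▸ smul_ne_zero (inv_ne_zero hu0) hu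
  have hζd : ∀ j, ζ j ^ d = 1 := by
    intro j
    simp only [ζ]
    split_ifs with h0
    · exact one_pow d
    · rw [div_pow, div_pow, ← hpow, ← hui, mul_div_cancel_left₀ _ (pow_ne_zero _ hμ0),
        div_self (pow_ne_zero _ h0)]
  have hζb : (ζ * b) ^ d = b ^ d := by
    funext j
    simp [mul_pow, hζd]
  have hRb : f.RVal (ζ * b) = f.RVal b := by
    rw [hζu, RVal_smul, ← hR, ← hμ, hui, inv_pow, inv_mul_cancel_left₀ (pow_ne_zero _ hu0)]
  rw [hf.RVal_eq, hf.RVal_eq, hζb, add_left_inj] at hRb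
  refine ⟨ζ, hζd, fun j hj => ?_, hRb, hne, ?_⟩
  · simp only [ζ]
    rcases hj with rfl | hj
    · rw [if_neg (by rw [hi₀]; exact one_ne_zero), hi₀, div_one, div_self hu0]
    · rw [if_pos hj]
  · rw [Projectivization.mk_eq_mk_iff', hζu]
    exact ⟨u i₀, by rw [smul_smul, mul_inv_cancel₀ hu0, one_smul]⟩

theorem exists_of_mem_X (hf : f.IsMixedPower t A a) (h : IsGenericTriple t A a) {z : CP k} (hz : z ∈ f.X) :
    ∃ (b : Fin k → ℂ) (hb : b ≠ 0), (∀ i, b i ∈ algClosureOf (entries t)) ∧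
      z = f.fInf (Projectivization.mk ℂ b hb) := by
  classical
  have hd := f.ne_zero_of_family
  obtain ⟨x, hx, rfl⟩ := hz
  obtain ⟨b, hb, i₀, hi₀, rfl⟩ := x.exists_eq_mk_normalized
  refine ⟨b, hb, ?_, rfl⟩
  let J : Finset (Fin k) := Finset.univ.filter fun j => j ≠ i₀ ∧ b j ≠ 0
  have hJ : ∀ j, j ∈ J ↔ j ≠ i₀ ∧ b j ≠ 0 := fun j => by simp [J]
  let s : Finset (Fin k → ℂ) := (Fintype.piFinset fun _ => Polynomial.nthRootsFinset d (1 : ℂ)).filter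
    fun ζ => (∀ j, j = i₀ ∨ b j = 0 → ζ j = 1) ∧ mixedForm d t (ζ * b) = mixedForm d t b
  have hs : ∀ ζ, ζ ∈ s ↔ (∀ j, ζ j ^ d = 1) ∧ (∀ j, j = i₀ ∨ b j = 0 → ζ j = 1) ∧
      mixedForm d t (ζ * b) = mixedForm d t b := fun ζ => by
    simp [s, Polynomial.mem_nthRootsFinset (Nat.pos_of_ne_zero hd)]
  set m := Fintype.card {j // j ≠ i₀ ∧ b j = 0} with hm
  have hJm : J.card + m + 1 = k := by
    have h1 : m = (Finset.univ.filter fun j => j ≠ i₀ ∧ b j = 0).card := Fintype.card_subtype _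
    have h2 : J.card = ((Finset.univ.erase i₀).filter fun j => ¬ b j = 0).card := by
      congr 1; ext j; simp [J]
    have h3 : (Finset.univ.filter fun j => j ≠ i₀ ∧ b j = 0) =
        (Finset.univ.erase i₀).filter fun j => b j = 0 := by ext j; simp
    rw [h1, h2, h3, add_comm (Finset.card _), Finset.card_filter_add_card_filter_not,
      Finset.card_erase_add_one (Finset.mem_univ _), Finset.card_univ, Fintype.card_fin]
  have hzs : ∀ z ∈ f.fPlus ⁻¹' {f.fPlus (Projectivization.mk ℂ b hb)},
      ∃ ζ ∈ s, ∃ h, z = Projectivization.mk ℂ (ζ * b) h := by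
    intro z hz
    obtain ⟨ζ, h1, h2, h3, h4⟩ := hf.exists_root_of_fPlus_eq h.det_ne_zero hb hi₀ hz
    exact ⟨ζ, (hs ζ).mpr ⟨h1, h2, h3⟩, h4⟩
  choose! ζ hζs hζ0 hζz using hzs
  have hinj : Set.InjOn ζ (f.fPlus ⁻¹' {f.fPlus (Projectivization.mk ℂ b hb)}) := by
    intro z hz z' hz' hzz
    rw [hζz z hz, hζz z' hz']
    simp only [hzz]
  have hfin : (f.fPlus ⁻¹' {f.fPlus (Projectivization.mk ℂ b hb)}).Finite :=
    Set.Finite.of_injOn (t := (s : Set (Fin k → ℂ))) hζs hinj s.finite_toSet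
  have hcount : f.fibreCount (Projectivization.mk ℂ b hb) ≤ (s.card * d ^ m : ℕ) := by
    rw [fibreCount, finsum_mem_eq_finite_toFinset_sum _ hfin]
    refine (Finset.sum_le_card_nsmul _ _ ((d ^ m : ℕ) : ℕ∞) fun z hz => ?_).trans ?_
    · have hz' := hfin.mem_toFinset.mp hz
      have hζ := (hs _).mp (hζs z hz')
      have h1 := hf.localMultiplicity_le h.det_ne_zero (hζ0 z hz') (i₀ := i₀)
        (by rw [Pi.mul_apply, hζ.2.1 i₀ (Or.inl rfl), hi₀, one_mul])
      rw [← hζz z hz'] at h1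
      have hne : ∀ j, ζ z j ≠ 0 := fun j h0 => by
        have := hζ.1 j
        rw [h0, zero_pow hd] at this
        exact zero_ne_one this
      have hcard : Fintype.card {j // j ≠ i₀ ∧ (ζ z * b) j = 0} = m :=
        Fintype.card_congr (Equiv.subtypeEquivRight fun j => by simp [hne])
      rwa [hcard] at h1
    · rw [nsmul_eq_mul, ← Nat.cast_mul, Nat.cast_le]
      refine Nat.mul_le_mul_right _ (Finset.card_le_card_of_injOn ζ (fun z hz => ?_) fun z hz z' hz' => ?_)
      · exact hζs z (by simpa using hz)
      · exact hinj (by simpa using hz) (by simpa using hz')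
  -- With `J.card + m + 1 = k`, dividing out the multiplicity `d ^ m` leaves more than `d ^ (J.card
  -- - 1)` roots of unity when `J` is nonempty. If `J` is empty, the truncated exponent is useless,
  -- but `b` is then a coordinate vector.
  have hlt : d ^ (k - 2) < s.card * d ^ m := by
    have h1 := (show ((d ^ (k - 2) + 1 : ℕ) : ℕ∞) ≤ _ from hx).trans hcount
    exact_mod_cast h1
  rcases Nat.eq_zero_or_pos J.card with hJ0 | hJpos
  · intro i
    by_cases hi : i = i₀
    · rw [hi, hi₀]; exact one_mem _
    · have hi0 : b i = 0 := by
        by_contra h0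
        have := (hJ i).mpr ⟨hi, h0⟩
        rw [Finset.card_eq_zero.mp hJ0] at this
        simp at this
      rw [hi0]; exact zero_mem _
  · refine mem_algClosureOf_of_mixedForm_eq hd
      ((h.comp Sum.inl Sum.inl_injective).comp Sum.inl Sum.inl_injective) hi₀ J hJ s
      (fun ζ hζ => ((hs ζ).mp hζ).1) (fun ζ hζ j hj => ((hs ζ).mp hζ).2.1 j ?_)
      (fun ζ hζ => ((hs ζ).mp hζ).2.2) ?_
    · rw [hJ] at hj
      tauto
    · rw [show k - 2 = J.card - 1 + m by omega, pow_add] at hlt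
      exact lt_of_mul_lt_mul_right hlt (Nat.zero_le _)

theorem dotProduct_mem_of_mem_YNegTwo (hf : f.IsMixedPower t A a) (hA : A.det ≠ 0) {c : Fin k → ℂ} (hc : c ≠ 0)
    (h : Projectivization.mk ℂ c hc ∈ f.YNegTwo) :
    a ⬝ᵥ c ^ d ∈ algClosureOf (entries t ∪ Set.range c) := by
  have hd := f.ne_zero_of_family
  set C := algClosureOf (entries t ∪ Set.range c)
  have hcC : ∀ i, c i ∈ C := fun i => subset_algClosureOf _ (Or.inr ⟨i, rfl⟩)
  have hmixed : ∀ u : Fin k → ℂ, (∀ i, u i ∈ C) → mixedForm d t u ∈ C := fun u hu =>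
    sum_mem fun i _ => sum_mem fun j _ =>
      mul_mem (subset_algClosureOf _ (Or.inl (mem_entries t i j))) (mul_mem (pow_mem (hu i) _) (hu j))
  rcases h with h | ⟨z', hplus, hinf, heps⟩
  · obtain ⟨e, he⟩ := Projectivization.exists_smul_eq_mk_rep ℂ c hc
    have h1 : f.RVal (e • c) = 0 := by rw [he]; exact h
    rw [Units.smul_def, RVal_smul, mul_eq_zero, or_iff_right (pow_ne_zero _ e.ne_zero),
      hf.RVal_eq] at h1
    rw [eq_neg_of_add_eq_zero_right h1]
    exact neg_mem (hmixed c hcC)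
  · obtain ⟨u₀, hu₀, -, -, rfl⟩ := z'.exists_eq_mk_normalized
    -- Rescaling the second point gives lifts with the same image under `f_∞`, so the remaining
    -- conditions compare just `R` and its `d`-th power.
    obtain ⟨u, hu, huc, huz⟩ : ∃ (u : Fin k → ℂ) (hu : u ≠ 0), u ^ d = c ^ d ∧
        Projectivization.mk ℂ u₀ hu₀ = Projectivization.mk ℂ u hu := by
      obtain ⟨_, h2⟩ := hf.fInf_mk c hc
      obtain ⟨_, h3⟩ := hf.fInf_mk u₀ hu₀
      rw [h2, h3, Projectivization.mk_eq_mk_iff'] at hinf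
      obtain ⟨e, he⟩ := hinf
      obtain ⟨μ, hμ⟩ := IsAlgClosed.exists_pow_nat_eq e (Nat.pos_of_ne_zero hd)
      rw [← hμ, ← powMap_smul, powMap_eq_powMap_iff hA] at he
      have hμ0 : μ ≠ 0 := by
        rintro rfl
        rw [zero_smul, zero_pow hd] at he
        exact hc (by simpa [hd] using he.symm)
      refine ⟨μ • u₀, smul_ne_zero hμ0 hu₀, he, ?_⟩
      rw [Projectivization.mk_eq_mk_iff']
      exact ⟨μ⁻¹, by rw [smul_smul, inv_mul_cancel₀ hμ0, one_smul]⟩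
    rw [huz] at hplus heps
    have hF : f.FVec u = f.FVec c := by
      rw [hf.FVec_eq, hf.FVec_eq, powMap_eq_powMap_iff hA, huc]
    have hne : f.RVal c ≠ f.RVal u := by
      intro h0
      refine hplus ?_
      rw [FamilyF.fPlus_mk, FamilyF.fPlus_mk]
      have : f.plusVec c = f.plusVec u := by rw [plusVec, plusVec, hF, h0]
      simp only [this]
    have hpow : f.RVal c ^ d = f.RVal u ^ d := by
      rw [FamilyF.fPlus_mk, FamilyF.fPlus_mk, fEps_mk, fEps_mk,
        Projectivization.mk_eq_mk_iff'] at heps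
      obtain ⟨e, he⟩ := heps
      have h1 : e • f.FVec (f.FVec c) = f.FVec (f.FVec c) := by
        funext i
        simpa [epsVec, plusVec, hF] using congrFun he i.castSucc
      have he1 : e = 1 := by
        obtain ⟨i, hi⟩ := Function.ne_iff.mp
          (f.FVec_ne_zero _ (f.FVec_ne_zero c hc))
        exact mul_right_cancel₀ hi ((congrFun h1 i).trans (one_mul _).symm)
      have h2 := congrFun he (Fin.last k)
      simp [epsVec, plusVec, hF, he1] at h2
      exact h2.symm
    have hu0 : f.RVal u ≠ 0 := by
      intro h0
      rw [h0, zero_pow hd, pow_eq_zero_iff hd] at hpow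
      exact hne (hpow.trans h0.symm)
    set ξ := f.RVal c / f.RVal u with hξ
    have hξ1 : ξ ≠ 1 := fun h0 => hne (by rwa [hξ, div_eq_one_iff_eq hu0] at h0)
    have hξC : ξ ∈ C := by
      refine mem_algClosureOf_of_pow_eq_one hd ?_
      rw [hξ, div_pow, hpow, div_self (pow_ne_zero _ hu0)]
    have huC : ∀ i, u i ∈ C := fun i => by
      refine mem_algClosureOf_of_pow hd ?_
      have : u i ^ d = c i ^ d := congrFun huc i
      rw [this]
      exact pow_mem (hcC i) d
    -- Both values of `R` contain the same term `a ⬝ᵥ c ^ d`; as the root of unity `ξ` is not 1, the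
    -- equation can be solved for it.
    have heq : f.RVal c = ξ * f.RVal u := by rw [hξ, div_mul_cancel₀ _ hu0]
    rw [hf.RVal_eq, hf.RVal_eq, huc] at heq
    have h1 : a ⬝ᵥ c ^ d = (ξ * mixedForm d t u - mixedForm d t c) * (1 - ξ)⁻¹ := by
      rw [eq_mul_inv_iff_mul_eq₀ (sub_ne_zero.mpr hξ1.symm)]
      linear_combination heq
    rw [h1]
    exact mul_mem (sub_mem (mul_mem hξC (hmixed u huC)) (hmixed c hcC))
      (inv_mem (sub_mem (one_mem _) hξC))

theorem exists_of_mem_Y (hf : f.IsMixedPower t A a) (hA : A.det ≠ 0) {v : Fin k → ℂ} {hv : v ≠ 0}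
    (h : Projectivization.mk ℂ v hv ∈ f.Y) :
    ∃ c : Fin k → ℂ, c ≠ 0 ∧ powMap d A (powMap d A c) = v ∧
      a ⬝ᵥ c ^ d ∈ algClosureOf (entries t ∪ Set.range c) := by
  have hd := f.ne_zero_of_family
  obtain ⟨x, hx, hxv⟩ := h
  obtain ⟨c₀, hc₀, -, -, rfl⟩ := x.exists_eq_mk_normalized
  obtain ⟨h1, h2⟩ := hf.iterate_fInf_mk c₀ hc₀ 2
  rw [h2, eq_comm, Projectivization.mk_eq_mk_iff'] at hxv
  obtain ⟨e, he⟩ := hxv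
  have he0 : e ≠ 0 := by
    rintro rfl
    exact hv (by rw [← he, zero_smul])
  -- The second iterate has degree `d ^ 2`, so scaling by `μ` hits the chosen lift `v` exactly.
  obtain ⟨μ, hμ⟩ := IsAlgClosed.exists_pow_nat_eq e (Nat.pos_of_ne_zero (pow_ne_zero 2 hd))
  have hμ0 : μ ≠ 0 := by
    rintro rfl
    exact he0 (by rw [← hμ, zero_pow (pow_ne_zero 2 hd)])
  have hc : μ • c₀ ≠ 0 := smul_ne_zero hμ0 hc₀
  refine ⟨μ • c₀, hc, ?_, hf.dotProduct_mem_of_mem_YNegTwo hA hc ?_⟩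
  · have := powMap_iterate_smul (d := d) A μ c₀ 2
    rw [hμ, he] at this
    exact this
  · have : Projectivization.mk ℂ (μ • c₀) hc = Projectivization.mk ℂ c₀ hc₀ := by
      rw [Projectivization.mk_eq_mk_iff']
      exact ⟨μ, rfl⟩
    rw [this]
    exact hx

theorem mk_notMem_Y (hf : f.IsMixedPower t A a) (h : IsGenericTriple t A a) {v : Fin k → ℂ} (hv : v ≠ 0)
    (hvC : ∀ i, v i ∈ algClosureOf (entries t ∪ entries A)) :
    Projectivization.mk ℂ v hv ∉ f.Y := by
  intro hY
  obtain ⟨c, hc, hcv, hac⟩ := hf.exists_of_mem_Y h.det_ne_zero hY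
  refine h.notMem_of_powMap_powMap f.ne_zero_of_family hc hac ?_
  rw [hcv]
  exact hvC

theorem X_inter_Y (hf : f.IsMixedPower t A a) (h : IsGenericTriple t A a) : f.X ∩ f.Y = ∅ := by
  rw [Set.eq_empty_iff_forall_notMem]
  rintro z ⟨hX, hY⟩
  obtain ⟨b, hb, hbt, rfl⟩ := hf.exists_of_mem_X h hX
  obtain ⟨h1, h2⟩ := hf.fInf_mk b hb
  rw [h2] at hY
  refine hf.mk_notMem_Y h h1 (powMap_mem (fun i j => ?_) fun i => ?_) hY
  · exact subset_algClosureOf _ (Or.inr (mem_entries A i j))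
  · exact algClosureOf_mono Set.subset_union_left (hbt i)

/-- Removing one application of the map, periodicity of the image of `b` makes an iterate of `b`
proportional to some `y` with `y ^ d = b ^ d`; such a `y` is algebraic over `t` and has the same
support as `b`. -/
theorem X_inter_ptsOfPeriod (hf : f.IsMixedPower t A a) (h : IsGenericTriple t A a) (hk : 2 ≤ k) {n : ℕ} (hn : 1 ≤ n) :
    f.X ∩ Function.ptsOfPeriod f.fInf n = ∅ := by
  have hd := f.ne_zero_of_family
  rw [Set.eq_empty_iff_forall_notMem]
  rintro z ⟨hX, hper⟩
  obtain ⟨b, hb, hbt, rfl⟩ := hf.exists_of_mem_X h hX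
  have h1 : f.fInf^[n] (f.fInf (Projectivization.mk ℂ b hb)) = f.fInf (Projectivization.mk ℂ b hb) :=
    hper
  obtain ⟨hw, h2⟩ := hf.iterate_fInf_mk b hb n
  obtain ⟨_, h3⟩ := hf.fInf_mk _ hw
  obtain ⟨_, h4⟩ := hf.fInf_mk b hb
  rw [← Function.iterate_succ_apply, Function.iterate_succ_apply', h2, h3, h4,
    Projectivization.mk_eq_mk_iff'] at h1
  obtain ⟨e, he⟩ := h1
  obtain ⟨μ, hμ⟩ := IsAlgClosed.exists_pow_nat_eq e (Nat.pos_of_ne_zero hd)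
  rw [← hμ, ← powMap_smul, powMap_eq_powMap_iff h.det_ne_zero] at he
  have hμ0 : μ ≠ 0 := by
    rintro rfl
    rw [zero_smul, zero_pow hd] at he
    exact hw (by simpa [hd] using he.symm)
  have hpow : ∀ i, (μ⁻¹ • (powMap d A)^[n] b) i ^ d = b i ^ d := fun i => by
    have h5 := congrFun he i
    simp only [Pi.pow_apply, Pi.smul_apply, smul_eq_mul, mul_pow] at h5 ⊢
    rw [← h5, inv_pow, inv_mul_cancel_left₀ (pow_ne_zero _ hμ0)]
  obtain ⟨m, rfl⟩ : ∃ m, n = m + 1 := ⟨n - 1, by omega⟩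
  refine h.powMap_iterate_ne_smul (d := d) hk hb hbt (y := μ⁻¹ • (powMap d A)^[m + 1] b) (fun i => ?_)
    (fun i hi h0 => ?_) μ m ?_
  · refine mem_algClosureOf_of_pow hd ?_
    rw [hpow]
    exact pow_mem (hbt i) d
  · have := hpow i
    rw [h0, zero_pow hd] at this
    exact hi ((pow_eq_zero_iff hd).mp this.symm)
  · rw [smul_smul, mul_inv_cancel₀ hμ0, one_smul]

theorem Y_inter_ptsOfPeriod (hf : f.IsMixedPower t A a) (h : IsGenericTriple t A a) {n : ℕ} (hn : 1 ≤ n) :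
    f.Y ∩ Function.ptsOfPeriod f.fInf n = ∅ := by
  rw [Set.eq_empty_iff_forall_notMem]
  rintro z ⟨hY, hper⟩
  obtain ⟨v, hv, -, -, rfl⟩ := z.exists_eq_mk_normalized
  have h1 : f.fInf^[n] (Projectivization.mk ℂ v hv) = Projectivization.mk ℂ v hv := hper
  obtain ⟨hw, h2⟩ := hf.iterate_fInf_mk v hv n
  rw [h2, Projectivization.mk_eq_mk_iff'] at h1
  obtain ⟨e, he⟩ := h1
  have he0 : e ≠ 0 := by
    rintro rfl
    exact hw (by rw [← he, zero_smul])
  have hdn : 1 < d ^ n := Nat.one_lt_pow (by omega) (by have := f.two_le; omega)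
  -- The exponent `d ^ n - 1` is chosen so that the lift `μ • v` is genuinely fixed, not only up to
  -- a scalar.
  obtain ⟨μ, hμ⟩ := IsAlgClosed.exists_pow_nat_eq e⁻¹ (n := d ^ n - 1) (by omega)
  have hμ0 : μ ≠ 0 := by
    rintro rfl
    rw [zero_pow (by omega)] at hμ
    exact inv_ne_zero he0 hμ.symm
  have hfix : (powMap d A)^[n] (μ • v) = μ • v := by
    rw [powMap_iterate_smul, ← he, smul_smul]
    congr 1
    rw [show d ^ n = d ^ n - 1 + 1 by omega, pow_succ, hμ, mul_right_comm, inv_mul_cancel₀ he0,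
      one_mul]
  have hmk : Projectivization.mk ℂ v hv = Projectivization.mk ℂ (μ • v) (smul_ne_zero hμ0 hv) := by
    rw [Projectivization.mk_eq_mk_iff']
    exact ⟨μ⁻¹, by rw [smul_smul, inv_mul_cancel₀ hμ0, one_smul]⟩
  rw [hmk] at hY
  refine hf.mk_notMem_Y h _ (fun i => ?_) hY
  exact algClosureOf_mono Set.subset_union_right
    (mem_algClosureOf_of_periodic f.two_le h.det_ne_zero hn hfix i)

/-- A return to `X` is excluded by the independence of the rows of `A`, and entry into `Y` because
the point is still algebraic over `t` and `A`. -/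
theorem fInf_notMem_Z_of_mem_X (hf : f.IsMixedPower t A a) (h : IsGenericTriple t A a) (hk : 2 ≤ k) {z : CP k}
    (hz : z ∈ f.X) : f.fInf z ∉ f.Z := by
  have hd := f.ne_zero_of_family
  obtain ⟨b, hb, hbt, rfl⟩ := hf.exists_of_mem_X h hz
  obtain ⟨h1, h2⟩ := hf.fInf_mk b hb
  obtain ⟨h3, h4⟩ := hf.fInf_mk _ h1
  rw [h2, h4]
  rintro (hX | hY)
  · obtain ⟨b', hb', hbt', heq⟩ := hf.exists_of_mem_X h hX
    obtain ⟨h5, h6⟩ := hf.fInf_mk b' hb'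
    rw [h6, Projectivization.mk_eq_mk_iff'] at heq
    obtain ⟨e, he⟩ := heq
    obtain ⟨μ, hμ⟩ := IsAlgClosed.exists_pow_nat_eq e (Nat.pos_of_ne_zero hd)
    rw [← hμ, ← powMap_smul, powMap_eq_powMap_iff h.det_ne_zero, smul_pow] at he
    exact h.pow_powMap_ne_smul hk hd hb hb' hbt hbt' _ he.symm
  · have hA : ∀ i j, A i j ∈ algClosureOf (entries t ∪ entries A) :=
      fun i j => subset_algClosureOf _ (Or.inr (mem_entries A i j))
    exact hf.mk_notMem_Y h h3 (powMap_mem hA (powMap_mem hA fun i =>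
      algClosureOf_mono Set.subset_union_left (hbt i))) hY

theorem iInter_preimage_Z (hf : f.IsMixedPower t A a) (h : IsGenericTriple t A a) (hk : 2 ≤ k) :
    (⋂ i ∈ Finset.range (k + 2 + 1), f.fInf^[i] ⁻¹' f.Z) = ∅ := by
  rw [Set.eq_empty_iff_forall_notMem]
  intro z hz
  simp only [Set.mem_iInter, Finset.mem_range, Set.mem_preimage] at hz
  -- A visit to `X` forces the next point out of `Z`, so only the last index, `k + 2`, can escape
  -- `Y`. The counting argument uses the indices `1, …, k + 1`.
  have hY : ∀ i < k + 2, f.fInf^[i] z ∈ f.Y := fun i hi => by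
    refine (hz i (by omega)).resolve_left fun hX => ?_
    refine hf.fInf_notMem_Z_of_mem_X h hk hX ?_
    rw [← Function.iterate_succ_apply' f.fInf]
    exact hz (i + 1) (by omega)
  obtain ⟨v, hv, i₀, hi₀, rfl⟩ := z.exists_eq_mk_normalized
  refine h.not_forall_exists_powMap_powMap f.ne_zero_of_family hi₀ fun i hi => ?_
  obtain ⟨h1, h2⟩ := hf.iterate_fInf_mk v hv (i + 1)
  have h3 := hY (i + 1) (by omega)
  rw [h2] at h3
  obtain ⟨c, -, hc⟩ := hf.exists_of_mem_Y h.det_ne_zero h3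
  exact ⟨c, hc⟩

end IsMixedPower

end FamilyF

end AttractingSets

theorem mainTheorem6 (k d : ℕ) (hk : 2 ≤ k) (hd : 2 ≤ d) :
    (∃ f : AttractingSets.FamilyF k d,
      f.X ∩ f.Y = ∅ ∧
      (∀ n : ℕ, 1 ≤ n → f.X ∩ Function.ptsOfPeriod f.fInf n = ∅) ∧
      (∀ n : ℕ, 1 ≤ n → f.Y ∩ Function.ptsOfPeriod f.fInf n = ∅)) ∧
    (AttractingSets.Omega k d).Nonempty := by
  obtain ⟨t, A, a, h⟩ := AttractingSets.exists_isGenericTriple k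
  obtain ⟨f, hf⟩ := AttractingSets.FamilyF.exists_isMixedPower hd t A a h.det_ne_zero
  exact ⟨⟨f, hf.X_inter_Y h, fun n hn => hf.X_inter_ptsOfPeriod h hk hn,
    fun n hn => hf.Y_inter_ptsOfPeriod h hn⟩, f, hf.X_inter_Y h, k + 2, hf.iInter_preimage_Z h hk⟩
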